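/- Let $\gamma_L,\gamma_R,\alpha_L,\alpha_R,b$ be real numbers, and consider the planar piecewise linear system with switching line $\{x=0\}$ $$\begin{cases} x'=2\gamma_L x-y,\quad y'=(\gamma_L^2-1)x-\alpha_L & \text{for } x<0,\\ x'=2\gamma_R x-y+b,\quad y'=(\gamma_R^2-1)x-\alpha_R & \text{for } x>0.\end{cases}$$ Assume $|\gamma_L|>1$, $|\gamma_R|>1$ (so that the equilibrium of each linear subsystem is a node with distinct real eigenvalues $\gamma-1,\gamma+1$) and $\alpha_L>0>\alpha_R$. If moreover $\gamma_L>0>\gamma_R$, $b>0$ and $\gamma_L+\gamma_R<0$, then the system has at most two crossing limit cycles. Here a crossing periodic orbit is the trace of a continuous periodic curve that satisfies the respective subsystem wherever $x<0$ or $x>0$, that meets the line $x=0$, and that meets it only at isolated instants and only at points where the $x$-components of the two vector fields are non-zero and have the same sign. A crossing limit cycle is a crossing periodic orbit that has a neighbourhood containing no other crossing periodic orbit. -/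

import Mathlib

open Filter Topology

/-- The affine planar vector field
`(x, y) ↦ !![2γ, -1; γ² - 1, 0] (x, y) - (-β, α)`, whose matrix has eigenvalues `γ - 1`, `γ + 1`;
its equilibrium is a node (with distinct real eigenvalues) when `|γ| > 1`. -/
def nodeField (γ α β : ℝ) (p : ℝ × ℝ) : ℝ × ℝ :=
  (2 * γ * p.1 - p.2 + β, (γ ^ 2 - 1) * p.1 - α)

/-- `c` is a `T`-periodic crossing solution of the planar discontinuous system
`p' = F p` for `p.1 < 0`, `p' = G p` for `p.1 > 0`, with switching line `{p.1 = 0}`.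
It is a continuous periodic curve that follows `F` on the left and `G` on the right, it does meet
the switching line, and it meets it only at crossing points (both vector fields have
first component different from zero, of one and the same sign) and at isolated instants,
so that it never slides along the line. -/
structure IsCrossingPeriodicSolution (F G : ℝ × ℝ → ℝ × ℝ) (T : ℝ) (c : ℝ → ℝ × ℝ) : Prop where
  period_pos : 0 < T
  periodic : Function.Periodic c T
  continuous : Continuous c
  left : ∀ t, (c t).1 < 0 → HasDerivAt c (F (c t)) t
  right : ∀ t, 0 < (c t).1 → HasDerivAt c (G (c t)) t
  meets : ∃ t, (c t).1 = 0
  crossing : ∀ t, (c t).1 = 0 → 0 < (F (c t)).1 * (G (c t)).1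
  isolated : ∀ t, (c t).1 = 0 → ∀ᶠ s in 𝓝[≠] t, (c s).1 ≠ 0

/-- A crossing periodic orbit, as a subset of the plane. -/
def IsCrossingPeriodicOrbit (F G : ℝ × ℝ → ℝ × ℝ) (Γ : Set (ℝ × ℝ)) : Prop :=
  ∃ (T : ℝ) (c : ℝ → ℝ × ℝ), IsCrossingPeriodicSolution F G T c ∧ Set.range c = Γ

/-- A crossing limit cycle: a crossing periodic orbit that is isolated, i.e. has a neighbourhood
containing no other crossing periodic orbit. -/
def IsCrossingLimitCycle (F G : ℝ × ℝ → ℝ × ℝ) (Γ : Set (ℝ × ℝ)) : Prop :=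
  IsCrossingPeriodicOrbit F G Γ ∧
    ∃ U : Set (ℝ × ℝ), IsOpen U ∧ Γ ⊆ U ∧
      ∀ Γ' : Set (ℝ × ℝ), IsCrossingPeriodicOrbit F G Γ' → Γ' ⊆ U → Γ' = Γ

/-! Put `g = γL`. The reflection `x ↦ -x`, combined with time reversal and the shift of `y` by `b`,
turns the right node into a left one with parameters `h = -γR` and `-αR > 0`; the hypotheses become
`1 < g < h`. By nesting of arcs, a crossing periodic orbit closes up after one arc on each side
(`exists_closed_arcs`). In the coordinates `D = y₀ - y₁`, `S = y₀ + y₁` of the two end ordinates,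
the left arcs form the curve `αL • (arcDiff g, arcSum g)` and the right arcs form `(-αR) • (arcDiff
h, arcSum h)` translated by `(0, 2b)`. Distinct orbits give distinct common points, so it suffices
that these curves meet at most twice (`arc_matching_at_most_two`).

Each curve is a graph over `D` with slope `-σ`, where `0 < σ < 1`. Three common points yield, by
Rolle, two abscissae where the slopes agree. This is impossible because at equal slopes `D dσ/dD`,
which does not see the scale factors, is larger for the smaller parameter (`slopeRate_lt`): the
difference of slopes then has negative derivative at each of its zeros, hence at most one zero.

To compare the rates, write the common slope as `σ = tanh w`. An arc of duration `t` becomes a line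
through three points of the graph of `sinh`, with abscissae `-w`, `v₁ = gt - w - t`, `v₂ = gt - w +
t`, and up to a positive factor and a constant depending only on `w` the rate is `sinh v₁ + sinh v₂
+ sinh (v₁ + v₂ - w)` (`slope_eq_chord`). Since `(v₂ + w) / (v₁ + w) = (g + 1) / (g - 1)`, a smaller
parameter means a steeper line, and the claim is that the sum increases with the slope
(`chord_sum_lt`).

The sign of that derivative is `chord_slope_ineq`. The bound `cosh (v₁ + v₂ - w) ≤ cosh v₁` removes
the third term, and in midpoint coordinates what remains is a two-point inequality for `coth z -
1/z` (`langevin_two_point`). It follows from polynomial barriers for the Riccati equation of that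
function. -/

/-- A function vanishing at `0` with positive derivative on `(0, ∞)` is positive there. -/
lemma pos_of_hasDerivAt_pos {f f' : ℝ → ℝ} (h0 : f 0 = 0) (hf : ∀ x, HasDerivAt f (f' x) x)
    (hf' : ∀ x, 0 < x → 0 < f' x) {x : ℝ} (hx : 0 < x) : 0 < f x := by
  have hm : StrictMonoOn f (Set.Ici 0) := by
    apply strictMonoOn_of_deriv_pos (convex_Ici 0)
    · exact fun y _ => (hf y).continuousAt.continuousWithinAt
    · intro y hy
      rw [interior_Ici] at hy
      rw [(hf y).deriv]
      exact hf' y hy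
  simpa [h0] using hm (Set.mem_Ici.2 le_rfl) (Set.mem_Ici.2 hx.le) hx

/-! ### Inequalities for the Langevin function -/

namespace Real

lemma sinh_lt_mul_cosh {z : ℝ} (hz : 0 < z) : sinh z < z * cosh z := by
  have := pos_of_hasDerivAt_pos (f := fun z => z * cosh z - sinh z) (f' := fun z => z * sinh z)
    (by simp) (fun x => by
      refine HasDerivAt.congr_deriv (((hasDerivAt_id' x).mul (hasDerivAt_cosh x)).sub (hasDerivAt_sinh x)) ?_
      simp) (fun x hx => mul_pos hx (sinh_pos_iff.2 hx)) hz
  simpa using this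

lemma two_mul_sinh_sq_lt {z : ℝ} (hz : 0 < z) :
    2 * sinh z ^ 2 < z ^ 2 + z * sinh z * cosh z := by
  have h1 : ∀ z : ℝ, 0 < z → 0 < 3 * z - 3 * (sinh z * cosh z) + 2 * (z * sinh z ^ 2) := by
    intro z hz
    refine pos_of_hasDerivAt_pos
      (f := fun z => 3 * z - 3 * (sinh z * cosh z) + 2 * (z * sinh z ^ 2))
      (f' := fun z => 4 * sinh z * (z * cosh z - sinh z))
      (by simp) (fun x => ?_) (fun x hx => ?_) hz
    · refine HasDerivAt.congr_deriv ((((hasDerivAt_id' x).const_mul 3).sub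
        (((hasDerivAt_sinh x).mul (hasDerivAt_cosh x)).const_mul 3)).add
        (((hasDerivAt_id' x).mul ((hasDerivAt_sinh x).pow 2)).const_mul 2)) ?_
      have := cosh_sq x
      simp only [Pi.pow_apply]
      push_cast
      linear_combination (-3) * this
    · have := sinh_lt_mul_cosh hx
      have := sinh_pos_iff.2 hx
      have : 0 < x * cosh x - sinh x := by linarith
      positivity
  have := pos_of_hasDerivAt_pos (f := fun z => z ^ 2 + z * (sinh z * cosh z) - 2 * sinh z ^ 2)
    (f' := fun z => 3 * z - 3 * (sinh z * cosh z) + 2 * (z * sinh z ^ 2))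
    (by simp) (fun x => by
      refine HasDerivAt.congr_deriv ((((hasDerivAt_id' x).pow 2).add ((hasDerivAt_id' x).mul
        ((hasDerivAt_sinh x).mul (hasDerivAt_cosh x)))).sub
        (((hasDerivAt_sinh x).pow 2).const_mul 2)) ?_
      have := cosh_sq x
      simp only [Pi.mul_apply]
      push_cast
      linear_combination x * this) h1 hz
  nlinarith [this]

/-- The fourth Padé bound for `coth`. -/
lemma pade_cosh_lt_sinh {z : ℝ} (hz : 0 < z) :
    cosh z * (105 * z + 10 * z ^ 3) < sinh z * (105 + 45 * z ^ 2 + z ^ 4) := by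
  -- The ladder of continued-fraction remainders of `coth`: each one vanishes at `0` and its
  -- derivative is `z` times the previous one, starting from `z * cosh z - sinh z`.
  have h1 : ∀ z : ℝ, 0 < z → 0 < sinh z * (3 + z ^ 2) - 3 * (z * cosh z) := by
    intro z hz
    refine pos_of_hasDerivAt_pos (f := fun z => sinh z * (3 + z ^ 2) - 3 * (z * cosh z))
      (f' := fun z => z * (z * cosh z - sinh z)) (by simp) (fun x => ?_) (fun x hx => ?_) hz
    · refine HasDerivAt.congr_deriv (((hasDerivAt_sinh x).mul (((hasDerivAt_id' x).pow 2).const_add 3)).sub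
        (((hasDerivAt_id' x).mul (hasDerivAt_cosh x)).const_mul 3)) ?_
      simp only [Pi.pow_apply]
      push_cast
      ring
    · have := sinh_lt_mul_cosh hx
      exact mul_pos hx (by linarith)
  have h2 : ∀ z : ℝ, 0 < z → 0 < cosh z * (15 * z + z ^ 3) - sinh z * (15 + 6 * z ^ 2) := by
    intro z hz
    refine pos_of_hasDerivAt_pos
      (f := fun z => cosh z * (15 * z + z ^ 3) - sinh z * (15 + 6 * z ^ 2))
      (f' := fun z => z * (sinh z * (3 + z ^ 2) - 3 * (z * cosh z))) (by simp) (fun x => ?_)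
      (fun x hx => mul_pos hx (h1 x hx)) hz
    refine HasDerivAt.congr_deriv (((hasDerivAt_cosh x).mul (((hasDerivAt_id' x).const_mul 15).add
      ((hasDerivAt_id' x).pow 3))).sub ((hasDerivAt_sinh x).mul
      ((((hasDerivAt_id' x).pow 2).const_mul 6).const_add 15))) ?_
    simp
    ring
  have := pos_of_hasDerivAt_pos
    (f := fun z => sinh z * (105 + 45 * z ^ 2 + z ^ 4) - cosh z * (105 * z + 10 * z ^ 3))
    (f' := fun z => z * (cosh z * (15 * z + z ^ 3) - sinh z * (15 + 6 * z ^ 2))) (by simp)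
    (fun x => by
      refine HasDerivAt.congr_deriv (((hasDerivAt_sinh x).mul (((((hasDerivAt_id' x).pow 2).const_mul 45).const_add
        105).add ((hasDerivAt_id' x).pow 4))).sub ((hasDerivAt_cosh x).mul
        (((hasDerivAt_id' x).const_mul 105).add (((hasDerivAt_id' x).pow 3).const_mul 10)))) ?_
      simp
      ring) (fun x hx => mul_pos hx (h2 x hx)) hz
  linarith [this]

/-- The Langevin function `coth z - 1 / z`. -/
noncomputable def langevin (z : ℝ) : ℝ := cosh z / sinh z - 1 / z

variable {z : ℝ}

lemma langevin_eq (hz : 0 < z) : langevin z = (z * cosh z - sinh z) / (z * sinh z) := by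
  have := (sinh_pos_iff.2 hz).ne'
  rw [langevin]
  field_simp

lemma hasDerivAt_langevin (hz : 0 < z) :
    HasDerivAt langevin (1 - langevin z ^ 2 - 2 * langevin z / z) z := by
  have hs := (sinh_pos_iff.2 hz).ne'
  have h := ((hasDerivAt_cosh z).div (hasDerivAt_sinh z) hs).sub
    ((hasDerivAt_const z (1 : ℝ)).div (hasDerivAt_id' z) hz.ne')
  have heq : langevin = (cosh / sinh) - ((fun _ : ℝ => (1 : ℝ)) / fun x => x) := by
    ext x
    simp [langevin]
  rw [heq]
  refine HasDerivAt.congr_deriv (h) ?_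
  simp
  field_simp
  ring

lemma langevin_pos (hz : 0 < z) : 0 < langevin z := by
  rw [langevin_eq hz]
  have := sinh_lt_mul_cosh hz
  exact div_pos (by linarith) (mul_pos hz (sinh_pos_iff.2 hz))

lemma langevin_lt_one (hz : 0 < z) : langevin z < 1 := by
  rw [langevin_eq hz, div_lt_one (mul_pos hz (sinh_pos_iff.2 hz))]
  have h1 := pos_of_hasDerivAt_pos (f := fun z => sinh z - z * (cosh z - sinh z))
    (f' := fun z => z * (cosh z - sinh z) + sinh z) (by simp) (fun x => by
      refine HasDerivAt.congr_deriv ((hasDerivAt_sinh x).sub ((hasDerivAt_id' x).mul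
        ((hasDerivAt_cosh x).sub (hasDerivAt_sinh x)))) ?_
      ring) (fun x hx => by
        have := sinh_pos_iff.2 hx
        have := sinh_lt_cosh x
        have : 0 < cosh x - sinh x := by linarith
        positivity) hz
  linarith [h1]

/-- The Langevin function is increasing. -/
lemma langevin_deriv_pos (hz : 0 < z) : 0 < 1 - langevin z ^ 2 - 2 * langevin z / z := by
  have hs := sinh_pos_iff.2 hz
  have h : 1 - langevin z ^ 2 - 2 * langevin z / z =
      (sinh z - z) * (sinh z + z) / (z ^ 2 * sinh z ^ 2) := by
    have := cosh_sq z
    rw [langevin_eq hz]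
    field_simp
    linear_combination (-z ^ 2) * this
  rw [h]
  have : z < sinh z := self_lt_sinh_iff.2 hz
  have : 0 < sinh z - z := by linarith
  positivity

/-- By the Riccati equation this is the negativity of the derivative of `langevin z / z`. -/
lemma mul_one_sub_langevin_sq_lt (hz : 0 < z) :
    z * (1 - langevin z ^ 2) < 3 * langevin z := by
  have hs := sinh_pos_iff.2 hz
  have h : 3 * langevin z - z * (1 - langevin z ^ 2) =
      (z ^ 2 + z * sinh z * cosh z - 2 * sinh z ^ 2) / (z * sinh z ^ 2) := by
    have := cosh_sq z
    rw [langevin_eq hz]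
    field_simp
    linear_combination (z ^ 2) * this
  have h2 := two_mul_sinh_sq_lt hz
  have : 0 < (z ^ 2 + z * sinh z * cosh z - 2 * sinh z ^ 2) / (z * sinh z ^ 2) :=
    div_pos (by linarith) (by positivity)
  linarith

lemma langevin_lt_pade (hz : 0 < z) :
    langevin z < z * (35 + z ^ 2) / (105 + 10 * z ^ 2) := by
  have hs := sinh_pos_iff.2 hz
  rw [langevin_eq hz, div_lt_div_iff₀ (by positivity) (by positivity)]
  nlinarith [pade_cosh_lt_sinh hz]

/-- A barrier principle for the Riccati equation of the Langevin function. -/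
lemma langevin_barrier {F F' : ℝ → ℝ} (hF : ∀ x, HasDerivAt F (F' x) x)
    (hF0 : ∀ᶠ z in 𝓝[>] 0, F (langevin z) ≤ z * (1 - langevin z ^ 2))
    (hcross : ∀ z, 0 < z → F (langevin z) = z * (1 - langevin z ^ 2) →
      (F' (langevin z) + 2 * z * langevin z) * (1 - langevin z ^ 2 - 2 * langevin z / z)
        < 1 - langevin z ^ 2) (hz : 0 < z) :
    F (langevin z) ≤ z * (1 - langevin z ^ 2) := by
  -- The equation is singular at `0`, so the comparison starts at a small `u > 0`. The hypothesis
  -- `hcross` says that the difference has negative derivative at every contact, so it cannot become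
  -- positive.
  obtain ⟨u, hu, hu0, huz⟩ := (hF0.and (Ioo_mem_nhdsGT hz)).exists
  have hd : ∀ x, 0 < x → HasDerivAt (fun x => F (langevin x) - x * (1 - langevin x ^ 2))
      ((F' (langevin x) + 2 * x * langevin x) * (1 - langevin x ^ 2 - 2 * langevin x / x)
        - (1 - langevin x ^ 2)) x := by
    intro x hx
    have h := hasDerivAt_langevin hx
    refine HasDerivAt.congr_deriv (((hF (langevin x)).comp x h).sub
      ((hasDerivAt_id' x).mul ((h.pow 2).const_sub 1))) ?_
    simp
    ring
  have := image_le_of_deriv_right_lt_deriv_boundary (a := u) (b := z)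
    (f := fun x => F (langevin x) - x * (1 - langevin x ^ 2)) (f' := _) (B := fun _ => 0)
    (B' := fun _ => 0)
    (fun x hx => (hd x (hu0.trans_le hx.1)).continuousAt.continuousWithinAt)
    (fun x hx => (hd x (hu0.trans_le hx.1)).hasDerivWithinAt)
    (by simpa using hu) (fun x => hasDerivAt_const x 0)
    (fun x hx h => by
      have := hcross x (hu0.trans_le hx.1) (by linarith [h])
      linarith) (x := z) ⟨huz.le, le_rfl⟩
  linarith [this]

/-- Provides the starting inequality of the barrier arguments near `0`, through the Padé bound for
the ratio `v = langevin z / z`. -/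
lemma langevin_bound_of_lt_one (hz : 0 < z) (hz1 : z < 1) :
    langevin z < 1 / 3 ∧
    3 * langevin z - 3 / 2 * langevin z ^ 3 ≤ z * (1 - langevin z ^ 2) := by
  have h := langevin_lt_pade hz
  have h0 := langevin_pos hz
  obtain ⟨v, hv⟩ : ∃ v, langevin z = z * v := ⟨langevin z / z, by field_simp⟩
  rw [hv] at h h0 ⊢
  have hv0 : 0 < v := pos_of_mul_pos_right h0 hz.le
  rw [mul_div_assoc, mul_lt_mul_iff_right₀ hz, lt_div_iff₀ (by positivity)] at h
  have hv1 : v < 1 / 3 := by nlinarith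
  have hz2 : z ^ 2 < 1 := by nlinarith
  -- The Padé bound gives `3v < 1 - 7z² / (105 + 10z²)`, and `7 / 115 > 3 / 50`. All that matters
  -- later is that `3 / 50` exceeds the constant `1 / 18` of the next step.
  have h3 : 3 * v ≤ 1 - 3 / 50 * z ^ 2 := by
    by_contra! hc
    have := mul_lt_mul_of_pos_right hc (show 0 < 105 + 10 * z ^ 2 by positivity)
    nlinarith [mul_nonneg (sq_nonneg z) (sub_nonneg.2 hz2.le)]
  -- The left side increases on `[0, 1/3]` and equals `1 / 18` at `1 / 3`.
  have h4 : v ^ 2 - 3 / 2 * v ^ 3 ≤ 1 / 18 := by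
    nlinarith [mul_pos hv0 hv0, mul_pos (mul_pos hv0 hv0) (sub_pos.2 hv1),
      mul_pos hv0 (sub_pos.2 hv1)]
  refine ⟨by nlinarith, ?_⟩
  have h5 : 3 * v + z ^ 2 * (v ^ 2 - 3 / 2 * v ^ 3) ≤ 1 := by
    nlinarith [mul_le_mul_of_nonneg_left h4 (sq_nonneg z), sq_nonneg z]
  nlinarith [mul_le_mul_of_nonneg_left h5 hz.le]

/-- At a contact with the barrier, `z` is a rational function of `p = langevin z`, so the crossing
condition becomes positivity of a rational function of `p` on `(0, 1)`. This barrier is the better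
one for `p ≤ 1 / 2`. -/
lemma langevin_cubic_bound (hz : 0 < z) :
    3 * langevin z - 3 / 2 * langevin z ^ 3 ≤ z * (1 - langevin z ^ 2) := by
  refine langevin_barrier (F := fun p => 3 * p - 3 / 2 * p ^ 3)
    (F' := fun p => 3 - 9 / 2 * p ^ 2) (fun x => ?_) ?_ (fun z hz h => ?_) hz
  · refine HasDerivAt.congr_deriv (((hasDerivAt_id' x).const_mul 3).sub
      (((hasDerivAt_id' x).pow 3).const_mul (3 / 2))) ?_
    push_cast
    ring
  · filter_upwards [Ioo_mem_nhdsGT one_pos] with z hz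
    exact (langevin_bound_of_lt_one hz.1 hz.2).2
  · have h0 := langevin_pos hz
    have h1 := langevin_lt_one hz
    set p := langevin z
    have hp : 0 < 1 - p ^ 2 := by nlinarith
    have hq : 0 < 3 - 3 / 2 * p ^ 2 := by nlinarith
    have hz' : z = p * (3 - 3 / 2 * p ^ 2) / (1 - p ^ 2) := by
      field_simp
      linarith
    have key : 1 - p ^ 2 - (3 - 9 / 2 * p ^ 2 + 2 * z * p) * (1 - p ^ 2 - 2 * p / z) =
        p ^ 2 * (3 / 2 - 9 / 4 * p ^ 2 + 9 / 4 * p ^ 4) / (3 - 3 / 2 * p ^ 2) := by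
      obtain ⟨u, hu⟩ : ∃ u, u = 3 - 3 / 2 * p ^ 2 := ⟨_, rfl⟩
      obtain ⟨v, hv⟩ : ∃ v, v = 1 - p ^ 2 := ⟨_, rfl⟩
      rw [hz', ← hu, ← hv]
      rw [← hu] at hq
      rw [← hv] at hp
      field_simp
      rw [hu, hv]
      ring
    have : 0 < p ^ 2 * (3 / 2 - 9 / 4 * p ^ 2 + 9 / 4 * p ^ 4) / (3 - 3 / 2 * p ^ 2) := by
      have : 0 < 3 / 2 - 9 / 4 * p ^ 2 + 9 / 4 * p ^ 4 := by nlinarith [sq_nonneg (p ^ 2 - 1 / 2)]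
      positivity
    linarith

/-- Same mechanism as for the cubic. The polynomial equals `(1 + p) * (1 - (1 - p) ^ 3)`; its value
`2` at `p = 1` is the limit of `z * (1 - p ^ 2)` at infinity, so the bound stays sharp for large
`z`. -/
lemma langevin_quartic_bound (hz : 0 < z) :
    3 * langevin z - 2 * langevin z ^ 3 + langevin z ^ 4 ≤ z * (1 - langevin z ^ 2) := by
  refine langevin_barrier (F := fun p => 3 * p - 2 * p ^ 3 + p ^ 4)
    (F' := fun p => 3 - 6 * p ^ 2 + 4 * p ^ 3) (fun x => ?_) ?_ (fun z hz h => ?_) hz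
  · refine HasDerivAt.congr_deriv ((((hasDerivAt_id' x).const_mul 3).sub
      (((hasDerivAt_id' x).pow 3).const_mul 2)).add ((hasDerivAt_id' x).pow 4)) ?_
    push_cast
    ring
  · filter_upwards [Ioo_mem_nhdsGT one_pos] with z hz
    obtain ⟨h1, h2⟩ := langevin_bound_of_lt_one hz.1 hz.2
    have := pow_pos (langevin_pos hz.1) 3
    nlinarith
  · have h0 := langevin_pos hz
    have h1 := langevin_lt_one hz
    set p := langevin z
    have hp : 0 < 1 - p ^ 2 := by nlinarith
    have hq : 0 < 3 - 2 * p ^ 2 + p ^ 3 := by nlinarith [pow_pos h0 3]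
    have hz' : z = p * (3 - 2 * p ^ 2 + p ^ 3) / (1 - p ^ 2) := by
      field_simp
      linarith
    have key : 1 - p ^ 2 - (3 - 6 * p ^ 2 + 4 * p ^ 3 + 2 * z * p) * (1 - p ^ 2 - 2 * p / z) =
        2 * p ^ 2 * (1 - p) ^ 3 * (2 + 3 * p - p ^ 3) / (3 - 2 * p ^ 2 + p ^ 3) := by
      obtain ⟨u, hu⟩ : ∃ u, u = 3 - 2 * p ^ 2 + p ^ 3 := ⟨_, rfl⟩
      obtain ⟨v, hv⟩ : ∃ v, v = 1 - p ^ 2 := ⟨_, rfl⟩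
      rw [hz', ← hu, ← hv]
      rw [← hu] at hq
      rw [← hv] at hp
      field_simp
      rw [hu, hv]
      ring
    have : 0 < 2 * p ^ 2 * (1 - p) ^ 3 * (2 + 3 * p - p ^ 3) / (3 - 2 * p ^ 2 + p ^ 3) := by
      have : 0 < 2 + 3 * p - p ^ 3 := by nlinarith
      have : 0 < 1 - p := by linarith
      positivity
    linarith

lemma tanh_eq_div_langevin (hz : 0 < z) : tanh z = z / (1 + z * langevin z) := by
  have hs := sinh_pos_iff.2 hz
  have hc := cosh_pos z
  rw [langevin, tanh_eq_sinh_div_cosh]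
  have : 1 + z * (cosh z / sinh z - 1 / z) = z * cosh z / sinh z := by
    field_simp
    ring
  rw [this]
  field_simp

/-- The left side is `1 - (1 - q) ^ 3` with `q = langevin z`. The quartic bound divided by `1 + q`
says that it is at most `z * (1 - q)`, while `tanh z = z / (1 + z * q)`. -/
lemma langevin_mul_le_tanh (hz : 0 < z) :
    langevin z * (3 - 3 * langevin z + langevin z ^ 2) ≤ tanh z := by
  have h0 := langevin_pos hz
  have h1 := langevin_lt_one hz
  have h2 := langevin_quartic_bound hz
  rw [tanh_eq_div_langevin hz, le_div_iff₀ (by positivity)]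
  set q := langevin z
  have h3 : q * (3 - 3 * q + q ^ 2) ≤ z * (1 - q) := by
    have : (1 + q) * (q * (3 - 3 * q + q ^ 2)) ≤ (1 + q) * (z * (1 - q)) := by nlinarith
    exact le_of_mul_le_mul_left this (by linarith)
  nlinarith [mul_nonneg (mul_nonneg hz.le h0.le) (pow_nonneg (sub_nonneg.2 h1.le) 3)]

lemma strictMonoOn_langevin : StrictMonoOn langevin (Set.Ioi 0) := by
  apply strictMonoOn_of_deriv_pos (convex_Ioi 0)
  · exact fun y hy => (hasDerivAt_langevin hy).continuousAt.continuousWithinAt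
  · intro y hy
    rw [interior_Ioi] at hy
    rw [(hasDerivAt_langevin hy).deriv]
    exact langevin_deriv_pos hy

lemma hasDerivAt_div_langevin (hz : 0 < z) :
    HasDerivAt (fun z => z / langevin z) (3 / langevin z + z - z / langevin z ^ 2) z := by
  have h0 := langevin_pos hz
  refine HasDerivAt.congr_deriv ((hasDerivAt_id' z).div (hasDerivAt_langevin hz) h0.ne') ?_
  field_simp
  ring

/-- Mean value bound for `z / langevin z`. -/
lemma div_langevin_sub_le {x y k : ℝ} (hx : 0 < x) (hxy : x < y)
    (hk : ∀ z, 0 < z → z ≤ y → 3 * langevin z - z * (1 - langevin z ^ 2) ≤ k * langevin z ^ 2) :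
    y * langevin x - x * langevin y ≤ (y - x) * k * (langevin x * langevin y) := by
  have h := (convex_Icc x y).image_sub_le_mul_sub_of_deriv_le (f := fun z => z / langevin z)
    (C := k)
    (fun z hz => (hasDerivAt_div_langevin (hx.trans_le hz.1)).continuousAt.continuousWithinAt)
    (fun z hz => by
      rw [interior_Icc] at hz
      exact (hasDerivAt_div_langevin (hx.trans hz.1)).differentiableAt.differentiableWithinAt)
    (fun z hz => by
      rw [interior_Icc] at hz
      have hz0 := hx.trans hz.1
      have h0 := langevin_pos hz0
      rw [(hasDerivAt_div_langevin hz0).deriv]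
      have : 3 / langevin z + z - z / langevin z ^ 2 =
          (3 * langevin z - z * (1 - langevin z ^ 2)) / langevin z ^ 2 := by
        field_simp
        ring
      rw [this, div_le_iff₀ (by positivity)]
      exact hk z hz0 hz.2.le)
    x ⟨le_rfl, hxy.le⟩ y ⟨hxy.le, le_rfl⟩ hxy.le
  have hP := langevin_pos (hx.trans hxy)
  have hQ := langevin_pos hx
  have h2 := mul_le_mul_of_nonneg_right h (mul_pos hQ hP).le
  have h3 : (y / langevin y - x / langevin x) * (langevin x * langevin y) =
      y * langevin x - x * langevin y := by
    field_simp
  linarith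

/-- The key one-sided estimate on two values of the Langevin function. -/
lemma langevin_two_point {x y : ℝ} (hx : 0 < x) (hxy : x < y) :
    2 * (y * langevin x - x * langevin y) ≤
      (y - x) * tanh x * (langevin y * (langevin y + langevin x)) := by
  have hy := hx.trans hxy
  have hP0 := langevin_pos hy
  have hP1 := langevin_lt_one hy
  have hQ0 := langevin_pos hx
  have hQP := strictMonoOn_langevin hx hy hxy
  have hth := langevin_mul_le_tanh hx
  have reduce : ∀ k, (∀ z, 0 < z → z ≤ y →
      3 * langevin z - z * (1 - langevin z ^ 2) ≤ k * langevin z ^ 2) →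
      2 * k ≤ (3 - 3 * langevin x + langevin x ^ 2) * (langevin y + langevin x) →
      2 * (y * langevin x - x * langevin y) ≤
      (y - x) * tanh x * (langevin y * (langevin y + langevin x)) := by
    intro k hk h2
    have h1 := div_langevin_sub_le hx hxy hk
    have h3 : 2 * k * langevin x ≤ tanh x * (langevin y + langevin x) := by
      calc 2 * k * langevin x ≤ ((3 - 3 * langevin x + langevin x ^ 2) *
            (langevin y + langevin x)) * langevin x := by gcongr
        _ = (langevin x * (3 - 3 * langevin x + langevin x ^ 2)) *
            (langevin y + langevin x) := by ring
        _ ≤ _ := by gcongr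
    have h4 := mul_le_mul_of_nonneg_left h3 (mul_pos (sub_pos.2 hxy) hP0).le
    linarith
  have hmono : ∀ z, 0 < z → z ≤ y → langevin z ≤ langevin y := fun z hz hzy =>
    strictMonoOn_langevin.monotoneOn hz hy hzy
  -- The cubic and quartic barriers give `k = 3P/2` and `k = 2P - P²`, which agree at `P = 1/2`; the
  -- smaller one is used on each side.
  rcases le_total (langevin y) (1 / 2) with hP | hP
  · refine reduce (3 / 2 * langevin y) (fun z hz hzy => ?_) ?_
    · have := langevin_cubic_bound hz
      have h2 := mul_le_mul_of_nonneg_right (hmono z hz hzy) (sq_nonneg (langevin z))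
      linarith
    · generalize langevin x = q at *
      generalize langevin y = p at *
      have : 0 ≤ 3 - 3 * q + q ^ 2 - p * (3 - q) := by nlinarith
      nlinarith [mul_nonneg hQ0.le this]
  · refine reduce (2 * langevin y - langevin y ^ 2) (fun z hz hzy => ?_) ?_
    · have := langevin_quartic_bound hz
      have h2 : 2 * langevin z - langevin z ^ 2 ≤ 2 * langevin y - langevin y ^ 2 := by
        nlinarith [hmono z hz hzy]
      have h3 := mul_le_mul_of_nonneg_right h2 (sq_nonneg (langevin z))
      linarith
    -- Both sides tend to the same value as `P, Q → 1`, hence the expansion about `1`.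
    · obtain ⟨A, hA⟩ : ∃ A, langevin x = 1 - A := ⟨1 - langevin x, by ring⟩
      obtain ⟨B, hB⟩ : ∃ B, langevin y = 1 - B := ⟨1 - langevin y, by ring⟩
      rw [hA] at hQP hQ0 ⊢
      rw [hB] at hQP hP1 hP ⊢
      have hBA : B < A := by linarith
      have hA1 : A < 1 := by linarith
      have hB0 : 0 < B := by linarith
      have hB1 : B ≤ 1 / 2 := by linarith
      have hA0 : 0 < A := by linarith
      have key : 0 ≤ 2 * A ^ 2 * (1 - A) + (A - B) * (1 - A + A ^ 2 - 2 * B) := by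
        have h1 : -(A * (1 - A)) ≤ 1 - A + A ^ 2 - 2 * B := by linarith
        have h2 := mul_le_mul_of_nonneg_left h1 (sub_pos.2 hBA).le
        have h3 : 0 ≤ A * (1 - A) := mul_nonneg hA0.le (by linarith)
        nlinarith [mul_nonneg hB0.le h3]
      linarith

end Real

/-! ### Chords of the graph of `sinh` through a fixed point -/

namespace Real

lemma tanh_div_antitone {x y : ℝ} (hx : 0 < x) (hxy : x ≤ y) :
    x * (sinh y * cosh x) ≤ y * (sinh x * cosh y) := by
  have hanti : StrictAntiOn (fun z => sinh z / (z * cosh z)) (Set.Ioi 0) := by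
    have hd : ∀ z : ℝ, 0 < z → HasDerivAt (fun z => sinh z / (z * cosh z))
        ((z - sinh z * cosh z) / (z * cosh z) ^ 2) z := by
      intro z hz
      have hc := cosh_pos z
      refine HasDerivAt.congr_deriv ((hasDerivAt_sinh z).div ((hasDerivAt_id' z).mul
        (hasDerivAt_cosh z)) (by positivity)) ?_
      have := cosh_sq z
      congr 1
      linear_combination z * this
    apply strictAntiOn_of_deriv_neg (convex_Ioi 0)
    · exact fun z hz => (hd z hz).continuousAt.continuousWithinAt
    · intro z hz
      rw [interior_Ioi] at hz
      have hz : 0 < z := hz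
      rw [(hd z hz).deriv]
      have hc := cosh_pos z
      have h1 : z < sinh z := self_lt_sinh_iff.2 hz
      have h2 := one_le_cosh z
      apply div_neg_of_neg_of_pos _ (by positivity)
      nlinarith
  have h := hanti.antitoneOn hx (hx.trans_le hxy) hxy
  have hy := hx.trans_le hxy
  have := cosh_pos x
  have := cosh_pos y
  rw [div_le_div_iff₀ (by positivity) (by positivity)] at h
  linarith

/-- At `z = 3x` the right side is `2 sinh (2x) cosh x > 4x cosh x`, and beyond `x` the difference of
the two sides grows. Thus a chord from `-x` to `z ≥ 3x` is steeper than the tangent at `x`. -/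
lemma cosh_mul_add_lt {x z : ℝ} (hx : 0 < x) (hz : 3 * x ≤ z) :
    cosh x * (z + x) < sinh z + sinh x := by
  have hmono : MonotoneOn (fun z => sinh z - cosh x * z) (Set.Ici x) := by
    have hd : ∀ z, HasDerivAt (fun z => sinh z - cosh x * z) (cosh z - cosh x) z := fun z =>
      HasDerivAt.congr_deriv ((hasDerivAt_sinh z).sub ((hasDerivAt_id' z).const_mul (cosh x)))
        (by ring)
    apply monotoneOn_of_deriv_nonneg (convex_Ici x)
    · exact fun z _ => (hd z).continuousAt.continuousWithinAt
    · exact fun z _ => (hd z).differentiableAt.differentiableWithinAt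
    · intro z hz
      rw [interior_Ici] at hz
      have hz : x < z := hz
      rw [(hd z).deriv, sub_nonneg, cosh_le_cosh, abs_of_pos hx, abs_of_pos (hx.trans hz)]
      exact hz.le
  have h := hmono (show x ≤ 3 * x by linarith) (show x ≤ z by linarith) hz
  have h3 : sinh (3 * x) + sinh x = 2 * sinh (2 * x) * cosh x := by
    rw [show 3 * x = 2 * x + x by ring, sinh_add, sinh_two_mul, cosh_two_mul]
    have := cosh_sq x
    linear_combination (-sinh x) * this
  have h2 : 2 * x < sinh (2 * x) := self_lt_sinh_iff.2 (by linarith)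
  have hc := cosh_pos x
  simp only at h
  nlinarith

section Chord

variable {w : ℝ}

/-- Slope of the chord of `sinh` from `-w` to `v`. -/
noncomputable def chordSlope (w v : ℝ) : ℝ := (sinh v + sinh w) / (v + w)

lemma hasDerivAt_chordSlope {v : ℝ} (hv : -w < v) :
    HasDerivAt (chordSlope w) ((cosh v - chordSlope w v) / (v + w)) v := by
  have hv' : v + w ≠ 0 := by linarith
  refine HasDerivAt.congr_deriv (((hasDerivAt_sinh v).add_const (sinh w)).div
    ((hasDerivAt_id' v).add_const w) hv') ?_
  rw [chordSlope]
  field_simp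

lemma chordSlope_lt_iff {v : ℝ} (hv : -w < v) :
    chordSlope w v < cosh v ↔ 0 < cosh v * (v + w) - (sinh v + sinh w) := by
  rw [chordSlope, div_lt_iff₀ (by linarith), sub_pos]

lemma lt_chordSlope_iff {v : ℝ} (hv : -w < v) :
    cosh v < chordSlope w v ↔ cosh v * (v + w) - (sinh v + sinh w) < 0 := by
  rw [chordSlope, lt_div_iff₀ (by linarith), sub_neg]

/-- The defect has the sign of the derivative of `chordSlope w`. It vanishes at `-w`, decreases up
to `0` and increases afterwards, so it changes sign at most once, from negative to positive:
`chordSlope w` is valley-shaped on `(-w, ∞)`. -/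
lemma hasDerivAt_chordDefect (w v : ℝ) :
    HasDerivAt (fun v => cosh v * (v + w) - (sinh v + sinh w)) (sinh v * (v + w)) v :=
  HasDerivAt.congr_deriv (((hasDerivAt_cosh v).mul ((hasDerivAt_id' v).add_const w)).sub
    ((hasDerivAt_sinh v).add_const (sinh w))) (by ring)

lemma strictMonoOn_chordDefect (hw : 0 < w) :
    StrictMonoOn (fun v => cosh v * (v + w) - (sinh v + sinh w)) (Set.Ici 0) := by
  apply strictMonoOn_of_deriv_pos (convex_Ici 0)
  · exact fun z _ => (hasDerivAt_chordDefect w z).continuousAt.continuousWithinAt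
  · intro z hz
    rw [interior_Ici] at hz
    have hz : 0 < z := hz
    rw [(hasDerivAt_chordDefect w z).deriv]
    exact mul_pos (sinh_pos_iff.2 hz) (by linarith)

lemma cosh_lt_chordSlope_of_nonpos {v : ℝ} (hv : -w < v) (hv0 : v ≤ 0) :
    cosh v < chordSlope w v := by
  have h : StrictAntiOn (fun v => cosh v * (v + w) - (sinh v + sinh w)) (Set.Icc (-w) 0) := by
    apply strictAntiOn_of_deriv_neg (convex_Icc _ _)
    · exact fun z _ => (hasDerivAt_chordDefect w z).continuousAt.continuousWithinAt
    · intro z hz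
      rw [interior_Icc] at hz
      rw [(hasDerivAt_chordDefect w z).deriv]
      exact mul_neg_of_neg_of_pos (sinh_neg_iff.2 hz.2) (by linarith [hz.1])
  rw [lt_chordSlope_iff hv]
  have := h (a := -w) (b := v) ⟨le_rfl, by linarith⟩ ⟨hv.le, hv0⟩ hv
  simpa using this

lemma cosh_lt_chordSlope_of_le (hw : 0 < w) {u v : ℝ} (hu : -w < u) (huv : u ≤ v)
    (hv : cosh v ≤ chordSlope w v) (hne : u < v ∨ cosh v < chordSlope w v) :
    cosh u < chordSlope w u := by
  rcases le_or_gt u 0 with h0 | h0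
  · exact cosh_lt_chordSlope_of_nonpos hu h0
  rcases huv.eq_or_lt with rfl | h
  · simpa using hne
  have h1 := strictMonoOn_chordDefect hw h0.le (h0.trans h).le h
  have h2 : ¬ chordSlope w v < cosh v := not_lt.2 hv
  rw [chordSlope_lt_iff (hu.trans h), not_lt] at h2
  rw [lt_chordSlope_iff hu]
  exact h1.trans_le h2

lemma chordSlope_lt_cosh_of_lt (hw : 0 < w) {u v : ℝ} (hu : -w < u) (huv : u < v)
    (h : chordSlope w u ≤ cosh u) : chordSlope w v < cosh v := by
  by_contra! hc
  exact absurd (cosh_lt_chordSlope_of_le hw hu huv.le hc (Or.inl huv)) (not_lt.2 h)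

lemma chordSlope_strictAnti (hw : 0 < w) {u v : ℝ} (hu : -w < u) (huv : u < v)
    (h : cosh v ≤ chordSlope w v) : chordSlope w v < chordSlope w u := by
  have : StrictAntiOn (chordSlope w) (Set.Icc u v) := by
    apply strictAntiOn_of_deriv_neg (convex_Icc _ _)
    · exact fun z hz =>
        (hasDerivAt_chordSlope (hu.trans_le hz.1)).continuousAt.continuousWithinAt
    · intro z hz
      rw [interior_Icc] at hz
      have hz' := hu.trans hz.1
      rw [(hasDerivAt_chordSlope hz').deriv]
      have := cosh_lt_chordSlope_of_le hw hz' hz.2.le h (Or.inl hz.2)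
      exact div_neg_of_neg_of_pos (by linarith) (by linarith)
  exact this ⟨le_rfl, huv.le⟩ ⟨huv.le, le_rfl⟩ huv

lemma chordSlope_strictMono (hw : 0 < w) {u v : ℝ} (hu : -w < u) (huv : u < v)
    (h : chordSlope w u ≤ cosh u) : chordSlope w u < chordSlope w v := by
  have : StrictMonoOn (chordSlope w) (Set.Icc u v) := by
    apply strictMonoOn_of_deriv_pos (convex_Icc _ _)
    · exact fun z hz =>
        (hasDerivAt_chordSlope (hu.trans_le hz.1)).continuousAt.continuousWithinAt
    · intro z hz
      rw [interior_Icc] at hz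
      have hz' := hu.trans hz.1
      rw [(hasDerivAt_chordSlope hz').deriv]
      have := chordSlope_lt_cosh_of_lt hw hu hz.1 h
      exact div_pos (by linarith) (by linarith)
  exact this ⟨le_rfl, huv.le⟩ ⟨huv.le, le_rfl⟩ huv

variable {v₁ v₂ : ℝ}

/-- Two points with the same chord slope lie on opposite sides of the valley: the left one strictly
on the decreasing branch, the right one strictly on the increasing branch. -/
lemma cosh_lt_chordSlope_left (hw : 0 < w) (h1 : -w < v₁) (h12 : v₁ < v₂)
    (h : chordSlope w v₁ = chordSlope w v₂) : cosh v₁ < chordSlope w v₁ := by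
  by_contra! hc
  exact (chordSlope_strictMono hw h1 h12 hc).ne h

lemma chordSlope_lt_cosh_right (hw : 0 < w) (h1 : -w < v₁) (h12 : v₁ < v₂)
    (h : chordSlope w v₁ = chordSlope w v₂) : chordSlope w v₂ < cosh v₂ := by
  by_contra! hc
  exact (chordSlope_strictAnti hw h1 h12 hc).ne' h

lemma chordSlope_between (hw : 0 < w) (h1 : -w < v₁) (h : chordSlope w v₁ = chordSlope w v₂)
    {z : ℝ} (hz1 : v₁ < z) (hz2 : z < v₂) : chordSlope w z < chordSlope w v₁ := by
  rcases le_total (cosh z) (chordSlope w z) with hc | hc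
  · exact chordSlope_strictAnti hw h1 hz1 hc
  · rw [h]
    exact chordSlope_strictMono hw (h1.trans hz1) hz2 hc

/-- If `-w < v₁ < v₂` are abscissae of collinear points of the graph of `sinh`, then
`|v₁ + v₂ - w| ≤ |v₁|`. -/
lemma cosh_add_sub_le (hw : 0 < w) (h1 : -w < v₁) (h12 : v₁ < v₂)
    (h : chordSlope w v₁ = chordSlope w v₂) : cosh (v₁ + v₂ - w) ≤ cosh v₁ := by
  have hl := cosh_lt_chordSlope_left hw h1 h12 h
  have hr := chordSlope_lt_cosh_right hw h1 h12 h
  have hv2 : 0 < v₂ := by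
    by_contra! hc
    exact absurd (cosh_lt_chordSlope_of_nonpos (h1.trans h12) hc) (not_lt.2 hr.le)
  -- Since `v₁ + v₂ - w = v₁ + 2M`, the claim asks that `v₁` lie beyond `-M`, on the side away from
  -- `0`. The location of `v₁` is decided by comparing the chord slope at `-M` with the common
  -- slope; their difference has the sign of `M tanh a - a tanh M`.
  obtain ⟨M, hM⟩ : ∃ M, M = (v₂ - w) / 2 := ⟨_, rfl⟩
  obtain ⟨a, ha⟩ : ∃ a, a = (v₂ + w) / 4 := ⟨_, rfl⟩
  have hv : v₂ = 2 * a + M := by linarith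
  have hww : w = 2 * a - M := by linarith
  have ha0 : 0 < a := by linarith
  have hslope : chordSlope w v₂ = sinh (2 * a) * cosh M / (2 * a) := by
    rw [chordSlope, hv, hww, sinh_add, sinh_sub]
    field_simp
    ring
  have hline : ∀ z : ℝ, z = -M → -w < z → chordSlope w z - chordSlope w v₂ =
      (4 * cosh a * (M * (sinh a * cosh M) - a * (sinh M * cosh a))) / (2 * a * (z + w)) := by
    intro z hz hzw
    have : z + w ≠ 0 := by linarith
    rw [hslope, chordSlope]
    field_simp
    rw [hz, hww, sinh_sub, sinh_neg, sinh_two_mul, cosh_two_mul]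
    have := cosh_sq a
    linear_combination (2 * a * sinh M) * this
  rcases lt_trichotomy w v₂ with hwv | hwv | hwv
  · have hM0 : 0 < M := by linarith
    -- This is `M < a`. Otherwise the line is steeper than the tangent at `w`, and it is steeper
    -- than the tangent at `v₁`; but by the mean value theorem its slope is `cosh ξ` with `-w < ξ <
    -- v₁`, so `|ξ| ≤ max w |v₁|`.
    have hv3 : v₂ < 3 * w := by
      by_contra! hc
      have h3 := cosh_mul_add_lt hw hc
      have h4 : cosh w < chordSlope w v₂ := by
        rw [chordSlope, lt_div_iff₀ (by linarith)]
        exact h3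
      obtain ⟨ξ, hξ, hξ'⟩ := exists_deriv_eq_slope sinh h1 continuous_sinh.continuousOn
        differentiable_sinh.differentiableOn
      have h5 : cosh ξ = chordSlope w v₁ := by
        rw [chordSlope, ← (hasDerivAt_sinh ξ).deriv, hξ', sinh_neg]
        ring
      rw [← h, ← h5, cosh_lt_cosh] at h4
      rw [← h5, cosh_lt_cosh] at hl
      rw [abs_of_pos hw] at h4
      have h6 : |ξ| ≤ max w |v₁| := by
        rw [abs_le]
        constructor
        · linarith [hξ.1, le_max_left w |v₁|]
        · linarith [hξ.2, le_max_right w |v₁|, le_abs_self v₁]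
      rcases le_max_iff.1 h6 with h7 | h7 <;> linarith
    have hle : v₁ ≤ -M := by
      by_contra! hc
      have hMw : -w < -M := by linarith
      have h3 := chordSlope_strictAnti hw hMw hc hl.le
      have h4 := hline (-M) rfl hMw
      have h5 := tanh_div_antitone hM0 (show M ≤ a by linarith)
      have h6 : (4 * cosh a * (M * (sinh a * cosh M) - a * (sinh M * cosh a))) /
          (2 * a * (-M + w)) ≤ 0 :=
        div_nonpos_of_nonpos_of_nonneg
          (mul_nonpos_of_nonneg_of_nonpos (by linarith [cosh_pos a]) (by linarith))
          (mul_nonneg (by linarith) (by linarith))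
      linarith
    rw [cosh_le_cosh, abs_le, abs_of_neg (show v₁ < 0 by linarith)]
    constructor <;> linarith
  · rw [hwv]
    simp
  · have hM0 : 0 < -M := by linarith
    -- This is `-M < a`. Otherwise the line is steeper than the tangent at `v₂`, although `v₂` lies
    -- on the increasing branch.
    have hv3 : w < 3 * v₂ := by
      by_contra! hc
      have h3 := cosh_mul_add_lt hv2 hc
      have h4 : cosh v₂ < chordSlope w v₂ := by
        rw [chordSlope, lt_div_iff₀ (by linarith)]
        linarith
      linarith
    have hle : -M ≤ v₁ := by
      by_contra! hc
      have hMw : -w < -M := by linarith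
      have h3 := chordSlope_between hw h1 h hc (by linarith)
      have h4 := hline (-M) rfl hMw
      have h5 := tanh_div_antitone hM0 (show -M ≤ a by linarith)
      rw [cosh_neg, sinh_neg] at h5
      have h6 : 0 ≤ (4 * cosh a * (M * (sinh a * cosh M) - a * (sinh M * cosh a))) /
          (2 * a * (-M + w)) :=
        div_nonneg (mul_nonneg (by linarith [cosh_pos a]) (by linarith))
          (mul_nonneg (by linarith) (by linarith))
      linarith
    rw [cosh_le_cosh, abs_le, abs_of_pos (show 0 < v₁ by linarith)]
    constructor <;> linarith

end Chord
end Real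

/-- A function with positive derivative on an open interval has a differentiable left inverse
there. -/
lemma exists_leftInverse_hasDerivAt {f f' : ℝ → ℝ} {s : Set ℝ} (hs : IsOpen s)
    (hconv : Convex ℝ s) (hf : ∀ x ∈ s, HasDerivAt f (f' x) x) (hpos : ∀ x ∈ s, 0 < f' x) :
    ∃ φ : ℝ → ℝ, ∀ x ∈ s, φ (f x) = x ∧ HasDerivAt φ (f' x)⁻¹ (f x) := by
  have hmono : StrictMonoOn f s := by
    apply strictMonoOn_of_deriv_pos hconv
    · exact fun x hx => (hf x hx).continuousAt.continuousWithinAt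
    · intro x hx
      rw [hs.interior_eq] at hx
      rw [(hf x hx).deriv]
      exact hpos x hx
  have hcont : ContinuousOn f s := fun x hx => (hf x hx).continuousAt.continuousWithinAt
  obtain ⟨φ, hφ⟩ : ∃ φ : ℝ → ℝ, ∀ x ∈ s, φ (f x) = x :=
    ⟨Function.invFunOn f s, fun x hx => hmono.injOn.leftInvOn_invFunOn hx⟩
  have himg : ∀ x ∈ s, f '' s ∈ 𝓝 (f x) := by
    intro x hx
    obtain ⟨ε, hε, hball⟩ := Metric.isOpen_iff.1 hs x hx
    have h1 : x - ε / 2 ∈ s := hball (by simp [abs_of_pos hε, hε])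
    have h2 : x + ε / 2 ∈ s := hball (by simp [abs_of_pos hε, hε])
    have h3 : Set.Icc (x - ε / 2) (x + ε / 2) ⊆ s := hconv.ordConnected.out h1 h2
    have h4 := intermediate_value_Icc (by linarith) (hcont.mono h3)
    exact mem_of_superset
      (Icc_mem_nhds (hmono h1 hx (by linarith)) (hmono hx h2 (by linarith)))
      (h4.trans (Set.image_mono h3))
  refine ⟨φ, fun x hx => ⟨hφ x hx, ?_⟩⟩
  have hφcont : ContinuousAt φ (f x) := by
    apply continuousAt_of_monotoneOn_of_image_mem_nhds (s := f '' s)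
    · rintro _ ⟨y, hy, rfl⟩ _ ⟨z, hz, rfl⟩ hyz
      rw [hφ y hy, hφ z hz]
      exact (hmono.le_iff_le hy hz).1 hyz
    · exact himg x hx
    · rw [hφ x hx, Set.image_image, Set.image_congr hφ, Set.image_id']
      exact hs.mem_nhds hx
  apply HasDerivAt.of_local_left_inverse hφcont
  · rw [hφ x hx]
    exact hf x hx
  · exact (hpos x hx).ne'
  · filter_upwards [himg x hx]
    rintro _ ⟨y, hy, rfl⟩
    rw [hφ y hy]

/-! ### Rotating the chord -/

namespace Real

lemma strictAntiOn_langevin_div : StrictAntiOn (fun z => langevin z / z) (Set.Ioi 0) := by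
  have hd : ∀ z : ℝ, 0 < z → HasDerivAt (fun z => langevin z / z)
      ((z * (1 - langevin z ^ 2) - 3 * langevin z) / z ^ 2) z := by
    intro z hz
    refine HasDerivAt.congr_deriv ((hasDerivAt_langevin hz).div (hasDerivAt_id' z) hz.ne') ?_
    field_simp
    ring
  apply strictAntiOn_of_deriv_neg (convex_Ioi 0)
  · exact fun y hy => (hd y hy).continuousAt.continuousWithinAt
  · intro y hy
    rw [interior_Ioi] at hy
    have hy : 0 < y := hy
    rw [(hd y hy).deriv]
    exact div_neg_of_neg_of_pos (by linarith [mul_one_sub_langevin_sq_lt hy]) (by positivity)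

/-- Secants of `sinh z / z` as a function of `cosh z` are steeper than the tangent at the right
end. -/
lemma langevin_mul_cosh_sub_lt {x y : ℝ} (hx : 0 < x) (hxy : x < y) :
    langevin y * (cosh y - cosh x) * x < sinh y * x - y * sinh x := by
  have hy := hx.trans hxy
  have h : StrictAntiOn (fun z => langevin y / y * cosh z - sinh z / z) (Set.Icc x y) := by
    -- The derivative of `sinh z / z` with respect to `cosh z` is `langevin z / z`, which is
    -- decreasing.
    have hd : ∀ z : ℝ, 0 < z → HasDerivAt (fun z => langevin y / y * cosh z - sinh z / z)
        (sinh z * (langevin y / y - langevin z / z)) z := by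
      intro z hz
      have := sinh_pos_iff.2 hz
      refine HasDerivAt.congr_deriv (((hasDerivAt_cosh z).const_mul (langevin y / y)).sub
        ((hasDerivAt_sinh z).div (hasDerivAt_id' z) hz.ne')) ?_
      rw [langevin_eq hz]
      field_simp
    apply strictAntiOn_of_deriv_neg (convex_Icc _ _)
    · exact fun z hz => (hd z (hx.trans_le hz.1)).continuousAt.continuousWithinAt
    · intro z hz
      rw [interior_Icc] at hz
      have hz0 := hx.trans hz.1
      rw [(hd z hz0).deriv]
      exact mul_neg_of_pos_of_neg (sinh_pos_iff.2 hz0)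
        (sub_neg.2 (strictAntiOn_langevin_div hz0 hy hz.2))
  have h2 := h ⟨le_rfl, hxy.le⟩ ⟨hxy.le, le_rfl⟩ hxy
  have h3 := mul_lt_mul_of_pos_right h2 (mul_pos hy hx)
  have e1 : (langevin y / y * cosh y - sinh y / y) * (y * x) =
      langevin y * cosh y * x - sinh y * x := by
    field_simp
  have e2 : (langevin y / y * cosh x - sinh x / x) * (y * x) =
      langevin y * cosh x * x - y * sinh x := by
    field_simp
  rw [e1, e2] at h3
  linarith

variable {w v₁ v₂ : ℝ}

/-- In terms of the midpoint `μ`, the half-distance `δ` and `L = μ + w`, the difference of the sides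
is a positive factor times an expression increasing in `tanh μ > 0`. Collinearity forces `tanh μ >
langevin L`, and at `langevin L` the expression is nonnegative by `langevin_two_point`. -/
lemma chord_slope_ineq_aux (h1 : -w < v₁) (h12 : v₁ < v₂)
    (h : chordSlope w v₁ = chordSlope w v₂) :
    2 * (v₁ + w) * cosh v₁ * (cosh v₂ - chordSlope w v₁) <
      (v₂ + w) * (chordSlope w v₁ - cosh v₁) * (cosh v₁ + cosh v₂) := by
  have hm1 : chordSlope w v₁ * (v₁ + w) = sinh v₁ + sinh w := by
    rw [chordSlope]
    have : v₁ + w ≠ 0 := by linarith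
    field_simp
  have hm2 : chordSlope w v₁ * (v₂ + w) = sinh v₂ + sinh w := by
    rw [h, chordSlope]
    have : v₂ + w ≠ 0 := by linarith
    field_simp
  generalize chordSlope w v₁ = m at *
  obtain ⟨μ, hμ⟩ : ∃ μ, μ = (v₁ + v₂) / 2 := ⟨_, rfl⟩
  obtain ⟨δ, hδ⟩ : ∃ δ, δ = (v₂ - v₁) / 2 := ⟨_, rfl⟩
  obtain ⟨L, hL⟩ : ∃ L, L = μ + w := ⟨_, rfl⟩
  have e1 : v₁ = μ - δ := by linarith
  have e2 : v₂ = μ + δ := by linarith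
  have e3 : w = L - μ := by linarith
  have hδ0 : 0 < δ := by linarith
  have hδL : δ < L := by linarith
  have hcμ := cosh_pos μ
  have hcδ := cosh_pos δ
  have hsδ := sinh_pos_iff.2 hδ0
  have hT : sinh μ = tanh μ * cosh μ := by
    rw [tanh_eq_sinh_div_cosh]
    field_simp
  have hθ : sinh δ = tanh δ * cosh δ := by
    rw [tanh_eq_sinh_div_cosh]
    field_simp
  have hm : δ * m = cosh μ * sinh δ := by
    have := congrArg₂ (· - ·) hm2 hm1
    simp only [e1, e2, e3, sinh_add, sinh_sub] at this
    linarith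
  have hTe : tanh μ * (cosh L - cosh δ) * δ = sinh L * δ - L * sinh δ := by
    have := congrArg₂ (· + ·) hm2 hm1
    simp only [e1, e2, e3, sinh_add, sinh_sub] at this
    rw [hT] at this
    apply mul_left_cancel₀ hcμ.ne'
    linear_combination (δ / 2) * this - L * hm
  have hPT : langevin L < tanh μ := by
    have h1 := langevin_mul_cosh_sub_lt hδ0 hδL
    rw [← hTe] at h1
    have h2 : 0 < cosh L - cosh δ := by
      rw [sub_pos, cosh_lt_cosh, abs_of_pos hδ0, abs_of_pos (hδ0.trans hδL)]
      exact hδL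
    exact lt_of_mul_lt_mul_right (lt_of_mul_lt_mul_right h1 hδ0.le) h2.le
  have hP0 := langevin_pos (hδ0.trans hδL)
  have hQ0 := langevin_pos hδ0
  have htp := langevin_two_point hδ0 hδL
  have hθ0 : 0 < tanh δ := pos_of_mul_pos_left (hθ ▸ hsδ) hcδ.le
  have hkey : 0 < 2 * δ * tanh μ - 2 * L * langevin δ +
      (L - δ) * tanh δ * (tanh μ * (tanh μ + langevin δ)) := by
    have h1 : langevin L * (langevin L + langevin δ) < tanh μ * (tanh μ + langevin δ) := by
      nlinarith
    have h2 := mul_lt_mul_of_pos_left h1 (mul_pos (sub_pos.2 hδL) hθ0)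
    nlinarith
  have hQ : δ * sinh δ * langevin δ = δ * cosh δ - sinh δ := by
    rw [langevin_eq hδ0]
    field_simp
  have f1 : m - cosh v₁ = cosh μ * sinh δ * (tanh μ - langevin δ) := by
    apply mul_left_cancel₀ hδ0.ne'
    rw [e1, cosh_sub, hT]
    linear_combination hm + cosh μ * hQ
  have f2 : cosh v₂ - m = cosh μ * sinh δ * (tanh μ + langevin δ) := by
    apply mul_left_cancel₀ hδ0.ne'
    rw [e2, cosh_add, hT]
    linear_combination -hm - cosh μ * hQ
  have f3 : cosh v₁ = cosh μ * cosh δ * (1 - tanh μ * tanh δ) := by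
    rw [e1, cosh_sub, hT, hθ]
    ring
  have f4 : cosh v₁ + cosh v₂ = 2 * (cosh μ * cosh δ) := by
    rw [e1, e2, cosh_sub, cosh_add]
    ring
  have : (v₂ + w) * (m - cosh v₁) * (cosh v₁ + cosh v₂) -
      2 * (v₁ + w) * cosh v₁ * (cosh v₂ - m) = 2 * cosh μ * cosh μ * cosh δ * sinh δ *
      (2 * δ * tanh μ - 2 * L * langevin δ +
        (L - δ) * tanh δ * (tanh μ * (tanh μ + langevin δ))) := by
    rw [f1, f2, f4, f3, e1, e2, e3]
    ring
  have h2 : 0 < 2 * cosh μ * cosh μ * cosh δ * sinh δ *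
      (2 * δ * tanh μ - 2 * L * langevin δ +
        (L - δ) * tanh δ * (tanh μ * (tanh μ + langevin δ))) := by positivity
  linarith

/-- This is positivity of the derivative of `sinh v₁ + sinh v₂ + sinh (v₁ + v₂ - w)` in the slope
`m`, where `dvᵢ/dm = (vᵢ + w) / (cosh vᵢ - m)` is negative for `i = 1` and positive for `i = 2`. The
worst case allowed by `cosh_add_sub_le` is `cosh (v₁ + v₂ - w) = cosh v₁`. -/
lemma chord_slope_ineq (hw : 0 < w) (h1 : -w < v₁) (h12 : v₁ < v₂)
    (h : chordSlope w v₁ = chordSlope w v₂) :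
    (v₁ + w) * (cosh v₁ + cosh (v₁ + v₂ - w)) * (cosh v₂ - chordSlope w v₁) <
      (v₂ + w) * (cosh v₂ + cosh (v₁ + v₂ - w)) * (chordSlope w v₁ - cosh v₁) := by
  have hl := cosh_lt_chordSlope_left hw h1 h12 h
  have hr := chordSlope_lt_cosh_right hw h1 h12 h
  have hC := cosh_add_sub_le hw h1 h12 h
  have hJ := chord_slope_ineq_aux h1 h12 h
  rw [← h] at hr
  have hC0 := cosh_pos (v₁ + v₂ - w)
  have hc1 := cosh_pos v₁
  generalize cosh (v₁ + v₂ - w) = C at *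
  generalize chordSlope w v₁ = m at *
  generalize cosh v₁ = c₁ at *
  generalize cosh v₂ = c₂ at *
  have g1 : (c₁ + c₂) * (c₁ + C) ≤ (c₂ + C) * (2 * c₁) := by
    have := mul_nonneg (sub_nonneg.2 hC) (sub_nonneg.2 (hl.trans hr).le)
    linarith
  have g2 := mul_le_mul_of_nonneg_left g1
    (mul_pos (show 0 < v₂ + w by linarith) (sub_pos.2 hl)).le
  have g3 := mul_lt_mul_of_pos_right hJ (show 0 < c₁ + C by linarith)
  have g4 : 2 * c₁ * ((v₁ + w) * (c₁ + C) * (c₂ - m)) <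
      2 * c₁ * ((v₂ + w) * (c₂ + C) * (m - c₁)) := by linarith
  exact lt_of_mul_lt_mul_left g4 (by linarith)

/-- Rotating a line about the point `(-w, -sinh w)` of the graph of `sinh`: the quantity
`sinh v₁ + sinh v₂ + sinh (v₁ + v₂ - w)` of the two further intersection points increases with the
slope of the line. -/
lemma chord_sum_lt (hw : 0 < w) {u₁ u₂ : ℝ} (h1 : -w < v₁) (h12 : v₁ < v₂)
    (h : chordSlope w v₁ = chordSlope w v₂) (hu1 : -w < u₁) (hu12 : u₁ < u₂)
    (hu : chordSlope w u₁ = chordSlope w u₂)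
    (hratio : (v₁ + w) * (u₂ + w) < (u₁ + w) * (v₂ + w)) :
    sinh u₁ + sinh u₂ + sinh (u₁ + u₂ - w) < sinh v₁ + sinh v₂ + sinh (v₁ + v₂ - w) := by
  have hl := cosh_lt_chordSlope_left hw h1 h12 h
  have hr := chordSlope_lt_cosh_right hw h1 h12 h
  have hul := cosh_lt_chordSlope_left hw hu1 hu12 hu
  have hur := chordSlope_lt_cosh_right hw hu1 hu12 hu
  -- If `u₁ ≤ v₁`, the line of the `u`'s is at least as steep, so `v₂ ≤ u₂` by the valley shape,
  -- against the hypothesis on the ratios. Hence the line of the `v`'s is strictly steeper.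
  have hvu : v₁ < u₁ := by
    by_contra! hc
    have h3 : chordSlope w v₁ ≤ chordSlope w u₁ := by
      rcases hc.eq_or_lt with h4 | h4
      · rw [h4]
      · exact (chordSlope_strictAnti hw hu1 h4 hl.le).le
    have h5 : v₂ ≤ u₂ := by
      by_contra! h6
      have := chordSlope_strictMono hw (hu1.trans hu12) h6 hur.le
      linarith
    nlinarith
  have hlt := chordSlope_strictAnti hw h1 hvu hul.le
  have huv : u₂ < v₂ := by
    by_contra! hc
    rcases hc.eq_or_lt with h4 | h4
    · rw [← h4, ← h] at hu
      linarith
    · have := chordSlope_strictMono hw (h1.trans h12) h4 hr.le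
      linarith
  -- The decreasing branch reaches past `u₁`; this makes `u₁` an interior point for the inverse
  -- function.
  obtain ⟨z, hz1, hz2⟩ : ∃ z, u₁ < z ∧ cosh z < chordSlope w z := by
    have hc : ContinuousAt (fun z => chordSlope w z - cosh z) u₁ :=
      (hasDerivAt_chordSlope hu1).continuousAt.sub continuous_cosh.continuousAt
    have : ∀ᶠ z in 𝓝[>] u₁, 0 < chordSlope w z - cosh z :=
      nhdsWithin_le_nhds (hc.eventually (lt_mem_nhds (by linarith)))
    obtain ⟨z, hz, hz'⟩ := (this.and self_mem_nhdsWithin).exists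
    exact ⟨z, hz', by linarith⟩
  -- The family of lines is parametrized by the right intersection `s`, and the left one is
  -- recovered by inverting the decreasing branch. The sign makes the inverted function increasing.
  obtain ⟨φ, hφ⟩ := exists_leftInverse_hasDerivAt (f := fun v => -chordSlope w v)
    (f' := fun v => -((cosh v - chordSlope w v) / (v + w))) (s := Set.Ioo (-w) z) isOpen_Ioo
    (convex_Ioo _ _) (fun x hx => (hasDerivAt_chordSlope hx.1).neg) (fun x hx => by
      have := cosh_lt_chordSlope_of_le hw hx.1 hx.2.le hz2.le (Or.inl hx.2)
      rw [neg_pos]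
      exact div_neg_of_neg_of_pos (by linarith) (by linarith [hx.1]))
  have hX : ∀ s ∈ Set.Icc u₂ v₂, ∃ x ∈ Set.Icc v₁ u₁, chordSlope w x = chordSlope w s := by
    intro s hs
    have hcont : ContinuousOn (chordSlope w) (Set.Icc v₁ u₁) := fun x hx =>
      (hasDerivAt_chordSlope (h1.trans_le hx.1)).continuousAt.continuousWithinAt
    apply intermediate_value_Icc' hvu.le hcont
    constructor
    · rw [hu]
      rcases hs.1.eq_or_lt with h4 | h4
      · rw [h4]
      · exact (chordSlope_strictMono hw (hu1.trans hu12) h4 hur.le).le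
    · rw [h]
      rcases hs.2.eq_or_lt with h4 | h4
      · rw [h4]
      · exact (chordSlope_strictMono hw ((hu1.trans hu12).trans_le hs.1) h4
          (by
            rcases hs.1.eq_or_lt with h5 | h5
            · rw [← h5]
              exact hur.le
            · exact (chordSlope_lt_cosh_of_lt hw (hu1.trans hu12) h5 hur.le).le)).le
  have hφX : ∀ s x, x ∈ Set.Icc v₁ u₁ → chordSlope w x = chordSlope w s →
      φ (-chordSlope w s) = x := by
    intro s x hx hxs
    rw [← hxs]
    exact (hφ x ⟨h1.trans_le hx.1, hx.2.trans_lt hz1⟩).1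
  have hd : ∀ s ∈ Set.Icc u₂ v₂, ∃ k', 0 < k' ∧
      HasDerivAt (fun s => sinh (φ (-chordSlope w s)) + sinh s +
        sinh (φ (-chordSlope w s) + s - w)) k' s := by
    intro s hs
    obtain ⟨x, hx, hxs⟩ := hX s hs
    have hx1 := h1.trans_le hx.1
    have hsw : -w < s := (hu1.trans hu12).trans_le hs.1
    have hxs' : x < s := hx.2.trans_lt (hu12.trans_le hs.1)
    have hJ := chord_slope_ineq hw hx1 hxs' hxs
    have hxl := cosh_lt_chordSlope_left hw hx1 hxs' hxs
    have hd1 := (hφ x ⟨hx1, hx.2.trans_lt hz1⟩).2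
    rw [hxs] at hd1
    have hd2 := hd1.comp s (hasDerivAt_chordSlope hsw).neg
    have hd2' : HasDerivAt (fun s => φ (-chordSlope w s)) _ s := hd2
    have e := hφX s x hx hxs
    refine ⟨_, ?_, (hd2'.sinh.add (hasDerivAt_sinh s)).add
      ((hd2'.add (hasDerivAt_id' s)).sub_const w).sinh⟩
    simp only [Pi.add_apply]
    rw [e]
    have p1 : 0 < x + w := by linarith
    have p2 : 0 < s + w := by linarith
    have p3 : 0 < chordSlope w x - cosh x := by linarith
    rw [← hxs]
    have : cosh x * ((-((cosh x - chordSlope w x) / (x + w)))⁻¹ *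
        -((cosh s - chordSlope w x) / (s + w))) + cosh s + cosh (x + s - w) *
        ((-((cosh x - chordSlope w x) / (x + w)))⁻¹ *
        -((cosh s - chordSlope w x) / (s + w)) + 1) =
        ((s + w) * (cosh s + cosh (x + s - w)) * (chordSlope w x - cosh x) -
        (x + w) * (cosh x + cosh (x + s - w)) * (cosh s - chordSlope w x)) /
        ((s + w) * (chordSlope w x - cosh x)) := by
      rw [← neg_div, neg_sub]
      field_simp
      ring
    rw [this]
    exact div_pos (by linarith) (by positivity)
  choose! k' hk0 hk using hd
  have hmono : StrictMonoOn (fun s => sinh (φ (-chordSlope w s)) + sinh s +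
        sinh (φ (-chordSlope w s) + s - w)) (Set.Icc u₂ v₂) := by
    apply strictMonoOn_of_deriv_pos (convex_Icc _ _)
    · exact fun s hs => (hk s hs).continuousAt.continuousWithinAt
    · intro s hs
      have hs' := interior_subset hs
      rw [(hk s hs').deriv]
      exact hk0 s hs'
  have := hmono ⟨le_rfl, huv.le⟩ ⟨huv.le, le_rfl⟩ huv
  simp only at this
  rwa [hφX u₂ u₁ ⟨hvu.le, le_rfl⟩ hu, hφX v₂ v₁ ⟨le_rfl, hvu.le⟩ h] at this

end Real

namespace Real

/-! Half-return maps of a linear node, parametrized by the time `t` spent in the half-plane. -/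

/-- Numerator of the slope of the half-return map in difference-sum coordinates. -/
noncomputable def slopeNum (g t : ℝ) : ℝ := g * cosh (g * t) * sinh t - sinh (g * t) * cosh t

/-- Denominator of the slope of the half-return map in difference-sum coordinates. -/
noncomputable def slopeDen (g t : ℝ) : ℝ :=
  g * sinh (g * t) * sinh t - cosh (g * t) * cosh t + 1

/-- Difference of the two ordinates joined by an arc of duration `t`. -/
noncomputable def arcDiff (g t : ℝ) : ℝ :=
  2 * (cosh (g * t) - cosh t) / ((g ^ 2 - 1) * sinh t)

/-- Sum of the two ordinates joined by an arc of duration `t`. -/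
noncomputable def arcSum (g t : ℝ) : ℝ :=
  2 * (g * sinh t - sinh (g * t)) / ((g ^ 2 - 1) * sinh t)

/-- Logarithmic rate of change of the slope with respect to the difference. -/
noncomputable def slopeRate (g t : ℝ) : ℝ :=
  (g ^ 2 - 1) * sinh t ^ 2 * (sinh (g * t) - g * sinh t) * (cosh (g * t) - cosh t) /
    slopeDen g t ^ 3

variable {g t : ℝ}

lemma hasDerivAt_sinh_mul (g t : ℝ) :
    HasDerivAt (fun t => sinh (g * t)) (g * cosh (g * t)) t :=
  ((hasDerivAt_id' t).const_mul g).sinh.congr_deriv (by ring)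

lemma hasDerivAt_cosh_mul (g t : ℝ) :
    HasDerivAt (fun t => cosh (g * t)) (g * sinh (g * t)) t :=
  ((hasDerivAt_id' t).const_mul g).cosh.congr_deriv (by ring)

lemma hasDerivAt_slopeNum (g t : ℝ) :
    HasDerivAt (slopeNum g) ((g ^ 2 - 1) * sinh (g * t) * sinh t) t :=
  ((((hasDerivAt_cosh_mul g t).const_mul g).mul (hasDerivAt_sinh t)).sub
    ((hasDerivAt_sinh_mul g t).mul (hasDerivAt_cosh t))).congr_deriv (by ring)

lemma hasDerivAt_slopeDen (g t : ℝ) :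
    HasDerivAt (slopeDen g) ((g ^ 2 - 1) * cosh (g * t) * sinh t) t :=
  (((((hasDerivAt_sinh_mul g t).const_mul g).mul (hasDerivAt_sinh t)).sub
    ((hasDerivAt_cosh_mul g t).mul (hasDerivAt_cosh t))).add_const 1).congr_deriv (by ring)

lemma sq_sub_one_pos (hg : 1 < g) : 0 < g ^ 2 - 1 := by nlinarith

lemma slopeNum_pos (hg : 1 < g) (ht : 0 < t) : 0 < slopeNum g t :=
  pos_of_hasDerivAt_pos (by simp [slopeNum]) (hasDerivAt_slopeNum g) (fun x hx => by
    have := sq_sub_one_pos hg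
    have := sinh_pos_iff.2 hx
    have := sinh_pos_iff.2 (show 0 < g * x by positivity)
    positivity) ht

/-- The slope therefore lies in `(0, 1)`: it can be written as `tanh w`, and both end ordinates are
monotone in the duration. -/
lemma slopeNum_lt_slopeDen (hg : 1 < g) (ht : 0 < t) : slopeNum g t < slopeDen g t := by
  have := pos_of_hasDerivAt_pos (f := fun t => slopeDen g t - slopeNum g t)
    (by simp [slopeNum, slopeDen])
    (fun x => (hasDerivAt_slopeDen g x).sub (hasDerivAt_slopeNum g x)) (fun x hx => by
      have h1 := sq_sub_one_pos hg
      have h2 := sinh_pos_iff.2 hx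
      have h3 := sinh_lt_cosh (g * x)
      nlinarith [mul_pos (mul_pos h1 (sub_pos.2 h3)) h2]) ht
  linarith

lemma slopeDen_pos (hg : 1 < g) (ht : 0 < t) : 0 < slopeDen g t :=
  (slopeNum_pos hg ht).trans (slopeNum_lt_slopeDen hg ht)

lemma hasDerivAt_arcDiff (hg : 1 < g) (ht : 0 < t) :
    HasDerivAt (arcDiff g) (2 * slopeDen g t / ((g ^ 2 - 1) * sinh t ^ 2)) t := by
  have h1 := sq_sub_one_pos hg
  have h2 := sinh_pos_iff.2 ht
  refine HasDerivAt.congr_deriv ((((hasDerivAt_cosh_mul g t).sub (hasDerivAt_cosh t)).const_mul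
    2).div ((hasDerivAt_sinh t).const_mul (g ^ 2 - 1)) (by positivity)) ?_
  have := cosh_sq t
  simp only [Pi.sub_apply, slopeDen]
  field_simp
  linear_combination this

lemma hasDerivAt_arcSum (hg : 1 < g) (ht : 0 < t) :
    HasDerivAt (arcSum g) (-(2 * slopeNum g t / ((g ^ 2 - 1) * sinh t ^ 2))) t := by
  have h1 := sq_sub_one_pos hg
  have h2 := sinh_pos_iff.2 ht
  refine HasDerivAt.congr_deriv (((((hasDerivAt_sinh t).const_mul g).sub
    (hasDerivAt_sinh_mul g t)).const_mul 2).div ((hasDerivAt_sinh t).const_mul (g ^ 2 - 1))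
    (by positivity)) ?_
  simp only [Pi.sub_apply, slopeNum]
  field_simp
  ring

lemma arcDiff_pos (hg : 1 < g) (ht : 0 < t) : 0 < arcDiff g t := by
  have h1 := sq_sub_one_pos hg
  have h2 := sinh_pos_iff.2 ht
  have h3 : cosh t < cosh (g * t) := by
    rw [cosh_lt_cosh, abs_of_pos ht, abs_of_pos (by positivity)]
    nlinarith
  have : 0 < cosh (g * t) - cosh t := by linarith
  rw [arcDiff]
  positivity

lemma hasDerivAt_slope (hg : 1 < g) (ht : 0 < t) :
    HasDerivAt (fun t => slopeNum g t / slopeDen g t)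
      ((g ^ 2 - 1) * sinh t * (sinh (g * t) - g * sinh t) / slopeDen g t ^ 2) t := by
  have h := slopeDen_pos hg ht
  refine HasDerivAt.congr_deriv ((hasDerivAt_slopeNum g t).div (hasDerivAt_slopeDen g t) h.ne') ?_
  congr 1
  have := cosh_sq (g * t)
  rw [slopeNum, slopeDen]
  linear_combination (-g * (g ^ 2 - 1) * sinh t ^ 2) * this

lemma slopeRate_eq (hg : 1 < g) (ht : 0 < t) : slopeRate g t =
    (g ^ 2 - 1) * sinh t * (sinh (g * t) - g * sinh t) / slopeDen g t ^ 2 * arcDiff g t /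
      (2 * slopeDen g t / ((g ^ 2 - 1) * sinh t ^ 2)) := by
  have h1 := sq_sub_one_pos hg
  have h2 := sinh_pos_iff.2 ht
  have h3 := slopeDen_pos hg ht
  rw [slopeRate, arcDiff]
  field_simp

/-- For the hyperbolic functions of `g * t` and `t`, and multiplied by the square of `k = cosh w /
slopeDen g t`, the right side is `cosh (g * t - 2 * w) + cosh t`. This turns the rate into a sum of
values of `sinh`. -/
lemma slope_identities {cL sL c s g : ℝ} (hL : cL ^ 2 = sL ^ 2 + 1) (h : c ^ 2 = s ^ 2 + 1) :
    (g ^ 2 - 1) * s ^ 2 * (cL - c) = (cL - c) * (g * sL * s - cL * c + 1) -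
      (sL - g * s) * (g * cL * s - sL * c) +
      c * ((g * sL * s - cL * c + 1) ^ 2 - (g * cL * s - sL * c) ^ 2) := by
  grind

/-- The arc of duration `t` corresponds to a line through three points of the graph of `sinh`. -/
lemma slope_eq_chord {w : ℝ} (hg : 1 < g) (ht : 0 < t)
    (hw : tanh w = slopeNum g t / slopeDen g t) :
    chordSlope w (g * t - w - t) = chordSlope w (g * t - w + t) ∧
    2 * cosh w ^ 3 * slopeRate g t = sinh (g * t - w - t) + sinh (g * t - w + t) +
      sinh ((g * t - w - t) + (g * t - w + t) - w) + sinh w := by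
  have hB := slopeDen_pos hg ht
  have hcw := cosh_pos w
  obtain ⟨k, hk⟩ : ∃ k, cosh w = k * slopeDen g t := ⟨cosh w / slopeDen g t, by field_simp⟩
  have hk' : sinh w = k * slopeNum g t := by
    rw [tanh_eq_sinh_div_cosh, hk] at hw
    have : k ≠ 0 := by
      rintro rfl
      simp at hk
      linarith
    field_simp at hw
    exact hw
  have hk2 : k ^ 2 * (slopeDen g t ^ 2 - slopeNum g t ^ 2) = 1 := by
    have := cosh_sq w
    rw [hk, hk'] at this
    linarith
  have hL := cosh_sq (g * t)
  have hδ := cosh_sq t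
  have hs : sinh (g * t - w) = k * (sinh (g * t) - g * sinh t) := by
    rw [sinh_sub, hk, hk', slopeDen, slopeNum]
    linear_combination (-k * g * sinh t) * hL
  have hc : cosh (g * t - w) = k * (cosh (g * t) - cosh t) := by
    rw [cosh_sub, hk, hk', slopeDen, slopeNum]
    linear_combination (-k * cosh t) * hL
  constructor
  · have h1 : g * t - w - t + w ≠ 0 := by nlinarith
    have h2 : g * t - w + t + w ≠ 0 := by nlinarith
    rw [chordSlope, chordSlope, div_eq_div_iff h1 h2, sinh_sub _ t, sinh_add, hs, hc, hk',
      slopeNum]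
    ring
  · have e1 : (g * t - w - t) + (g * t - w + t) - w = (g * t - w) + ((g * t - w) - w) := by ring
    have e2 : sinh ((g * t - w) + ((g * t - w) - w)) + sinh w =
        2 * (sinh (g * t - w) * cosh ((g * t - w) - w)) := by
      have : ∀ x y, sinh (x + y) + sinh (x - y) = 2 * (sinh x * cosh y) := fun x y => by
        rw [sinh_add, sinh_sub]
        ring
      have := this (g * t - w) ((g * t - w) - w)
      rwa [sub_sub_cancel] at this
    have e3 : sinh (g * t - w - t) + sinh (g * t - w + t) = 2 * (sinh (g * t - w) * cosh t) := by
      rw [sinh_sub _ t, sinh_add]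
      ring
    rw [e1, e3, add_assoc, e2, cosh_sub (g * t - w) w, hs, hc, hk, hk', slopeRate]
    have := slope_identities (g := g) hL hδ
    have e4 : 2 * (k * slopeDen g t) ^ 3 * ((g ^ 2 - 1) * sinh t ^ 2 *
        (sinh (g * t) - g * sinh t) * (cosh (g * t) - cosh t) / slopeDen g t ^ 3) =
        2 * k ^ 3 * (sinh (g * t) - g * sinh t) *
          ((g ^ 2 - 1) * sinh t ^ 2 * (cosh (g * t) - cosh t)) := by
      field_simp
    rw [e4, this, ← slopeDen, ← slopeNum]
    linear_combination (2 * k * (sinh (g * t) - g * sinh t) * cosh t) * hk2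

/-- At equal slopes, the slope of the node with the smaller parameter changes faster. -/
lemma slopeRate_lt {h r : ℝ} (hg : 1 < g) (hgh : g < h) (ht : 0 < t) (hr : 0 < r)
    (heq : slopeNum g t / slopeDen g t = slopeNum h r / slopeDen h r) :
    slopeRate h r < slopeRate g t := by
  have hh := hg.trans hgh
  have h0 : 0 < slopeNum g t / slopeDen g t := div_pos (slopeNum_pos hg ht) (slopeDen_pos hg ht)
  have h1 : slopeNum g t / slopeDen g t < 1 :=
    (div_lt_one (slopeDen_pos hg ht)).2 (slopeNum_lt_slopeDen hg ht)
  obtain ⟨w, hw⟩ : ∃ w, tanh w = slopeNum g t / slopeDen g t :=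
    ⟨artanh (slopeNum g t / slopeDen g t), tanh_artanh ⟨by linarith, h1⟩⟩
  have hcw := cosh_pos w
  have hw0 : 0 < w := by
    rw [← hw, tanh_eq_sinh_div_cosh] at h0
    exact sinh_pos_iff.1 ((div_pos_iff_of_pos_right hcw).1 h0)
  obtain ⟨a1, a2⟩ := slope_eq_chord hg ht hw
  obtain ⟨b1, b2⟩ := slope_eq_chord hh hr (hw.trans heq)
  -- The distances of the intersections from `-w` are `(g - 1) * t`, `(g + 1) * t` and `(h - 1) *
  -- r`, `(h + 1) * r`, so the hypothesis on the ratios is `g < h`.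
  have := chord_sum_lt hw0 (by nlinarith) (by linarith) a1 (by nlinarith) (by linarith) b1 (by
    have := mul_pos (mul_pos ht hr) (sub_pos.2 hgh)
    linarith)
  have h3 : 2 * cosh w ^ 3 * slopeRate h r < 2 * cosh w ^ 3 * slopeRate g t := by linarith
  exact lt_of_mul_lt_mul_left h3 (by positivity)

end Real

/-- A function whose derivative is negative at each of its zeros has at most one zero. -/
lemma zero_unique_of_deriv_neg_at_zeros {f f' : ℝ → ℝ} {a b : ℝ} (hab : a < b)
    (hf : ∀ x ∈ Set.Icc a b, HasDerivAt f (f' x) x)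
    (hneg : ∀ x ∈ Set.Icc a b, f x = 0 → f' x < 0) (ha : f a = 0) : f b ≠ 0 := by
  intro hb
  have hle : ∀ ⦃x⦄, x ∈ Set.Icc a b → f x ≤ 0 :=
    image_le_of_deriv_right_lt_deriv_boundary (B := fun _ => 0) (B' := fun _ => 0)
      (fun x hx => (hf x hx).continuousAt.continuousWithinAt)
      (fun x hx => (hf x ⟨hx.1, hx.2.le⟩).hasDerivWithinAt) ha.le (fun x => hasDerivAt_const x 0)
      (fun x hx h => hneg x ⟨hx.1, hx.2.le⟩ h)
  -- A zero at `b` with negative derivative forces positive values just to the left of `b`, against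
  -- `hle`.
  have h1 := hasDerivAt_iff_tendsto_slope.1 (hf b ⟨hab.le, le_rfl⟩)
  have h2 := h1.eventually (gt_mem_nhds (hneg b ⟨hab.le, le_rfl⟩ hb))
  have h3 : ∀ᶠ y in 𝓝[<] b, slope f b y < 0 :=
    h2.filter_mono (nhdsWithin_mono _ fun y hy => ne_of_lt hy)
  obtain ⟨y, hy, hy1, hy2⟩ := (h3.and (Ioo_mem_nhdsLT hab)).exists
  rw [slope_def_field, hb, sub_zero, div_neg_iff] at hy
  have := hle ⟨hy1.le, hy2.le⟩
  rcases hy with hy | hy <;> linarith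

/-! ### Intersections of the two difference–sum curves -/

namespace Real

lemma strictMonoOn_arcDiff {g : ℝ} (hg : 1 < g) : StrictMonoOn (arcDiff g) (Set.Ioi 0) := by
  apply strictMonoOn_of_deriv_pos (convex_Ioi 0)
  · exact fun y hy => (hasDerivAt_arcDiff hg hy).continuousAt.continuousWithinAt
  · intro y hy
    rw [interior_Ioi] at hy
    have hy : 0 < y := hy
    rw [(hasDerivAt_arcDiff hg hy).deriv]
    have := slopeDen_pos hg hy
    have := sq_sub_one_pos hg
    have := sinh_pos_iff.2 hy
    positivity

/-- The sum of the ordinates as a function of their difference. -/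
lemma exists_arcDiff_leftInverse {g p : ℝ} (hg : 1 < g) (hp : 0 < p) :
    ∃ φ : ℝ → ℝ, ∀ t, 0 < t → φ (p * arcDiff g t) = t ∧
      HasDerivAt (fun x => p * arcSum g (φ x)) (-(slopeNum g t / slopeDen g t))
        (p * arcDiff g t) ∧
      HasDerivAt (fun x => slopeNum g (φ x) / slopeDen g (φ x))
        (slopeRate g t / (p * arcDiff g t)) (p * arcDiff g t) := by
  have hpos : ∀ t, 0 < t → 0 < 2 * slopeDen g t / ((g ^ 2 - 1) * sinh t ^ 2) := by
    intro t ht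
    have := slopeDen_pos hg ht
    have := sq_sub_one_pos hg
    have := sinh_pos_iff.2 ht
    positivity
  obtain ⟨φ, hφ⟩ := exists_leftInverse_hasDerivAt (f := fun t => p * arcDiff g t)
    (s := Set.Ioi 0) isOpen_Ioi (convex_Ioi 0)
    (fun t ht => (hasDerivAt_arcDiff hg ht).const_mul p) (fun t ht => mul_pos hp (hpos t ht))
  refine ⟨φ, fun t ht => ?_⟩
  obtain ⟨h1, h2⟩ := hφ t ht
  have hB := slopeDen_pos hg ht
  have hs := sinh_pos_iff.2 ht
  have hg1 := sq_sub_one_pos hg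
  have hD := arcDiff_pos hg ht
  refine ⟨h1, ?_, ?_⟩
  · refine (((hasDerivAt_arcSum hg ht).comp_of_eq _ h2 h1.symm).const_mul p).congr_deriv ?_
    field_simp
  · refine ((hasDerivAt_slope hg ht).comp_of_eq _ h2 h1.symm).congr_deriv ?_
    rw [slopeRate_eq hg ht]
    field_simp

/-- The curves of pairs (difference, sum) of two nodes, one of them translated, meet at most
twice. -/
lemma arc_matching_at_most_two {g h p q k : ℝ} (hg : 1 < g) (hgh : g < h) (hp : 0 < p)
    (hq : 0 < q) {t₁ t₂ t₃ r₁ r₂ r₃ : ℝ} (ht₁ : 0 < t₁) (h12 : t₁ < t₂) (h23 : t₂ < t₃)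
    (hr₁ : 0 < r₁) (hr₂ : 0 < r₂) (hr₃ : 0 < r₃)
    (hd₁ : p * arcDiff g t₁ = q * arcDiff h r₁) (hd₂ : p * arcDiff g t₂ = q * arcDiff h r₂)
    (hd₃ : p * arcDiff g t₃ = q * arcDiff h r₃)
    (hs₁ : p * arcSum g t₁ = q * arcSum h r₁ + k) (hs₂ : p * arcSum g t₂ = q * arcSum h r₂ + k)
    (hs₃ : p * arcSum g t₃ = q * arcSum h r₃ + k) : False := by
  have hh := hg.trans hgh
  have ht₂ := ht₁.trans h12
  have ht₃ := ht₂.trans h23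
  obtain ⟨φ, hφ⟩ := exists_arcDiff_leftInverse hg hp
  obtain ⟨ψ, hψ⟩ := exists_arcDiff_leftInverse hh hq
  have hX12 : p * arcDiff g t₁ < p * arcDiff g t₂ :=
    mul_lt_mul_of_pos_left (strictMonoOn_arcDiff hg ht₁ ht₂ h12) hp
  have hX23 : p * arcDiff g t₂ < p * arcDiff g t₃ :=
    mul_lt_mul_of_pos_left (strictMonoOn_arcDiff hg ht₂ ht₃ h23) hp
  have hr13 : r₁ < r₃ := by
    by_contra! hc
    have := (strictMonoOn_arcDiff hh).monotoneOn hr₃ hr₁ hc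
    have := mul_le_mul_of_nonneg_left this hq.le
    linarith
  have hex : ∀ x ∈ Set.Icc (p * arcDiff g t₁) (p * arcDiff g t₃), ∃ t r, 0 < t ∧ 0 < r ∧
      p * arcDiff g t = x ∧ q * arcDiff h r = x := by
    intro x hx
    obtain ⟨t, ht, htx⟩ := intermediate_value_Icc (h12.trans h23).le
      (f := fun t => p * arcDiff g t) (fun t ht => ((hasDerivAt_arcDiff hg
        (ht₁.trans_le ht.1)).const_mul p).continuousAt.continuousWithinAt) hx
    rw [hd₁, hd₃] at hx
    obtain ⟨r, hr, hrx⟩ := intermediate_value_Icc hr13.le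
      (f := fun r => q * arcDiff h r) (fun r hr => ((hasDerivAt_arcDiff hh
        (hr₁.trans_le hr.1)).const_mul q).continuousAt.continuousWithinAt) hx
    exact ⟨t, r, ht₁.trans_le ht.1, hr₁.trans_le hr.1, htx, hrx⟩
  have hΨ : ∀ x ∈ Set.Icc (p * arcDiff g t₁) (p * arcDiff g t₃),
      HasDerivAt (fun x => p * arcSum g (φ x) - q * arcSum h (ψ x))
        (slopeNum h (ψ x) / slopeDen h (ψ x) - slopeNum g (φ x) / slopeDen g (φ x)) x := by
    intro x hx
    obtain ⟨t, r, ht, hr, htx, hrx⟩ := hex x hx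
    obtain ⟨a1, a2, -⟩ := hφ t ht
    obtain ⟨b1, b2, -⟩ := hψ r hr
    rw [htx] at a1 a2
    rw [hrx] at b1 b2
    rw [a1, b1]
    exact (a2.sub b2).congr_deriv (by ring)
  -- With `x` the common difference, `x` times the derivative of each slope is its `slopeRate`,
  -- whatever the scale factor `p` or `q`.
  have hZ : ∀ x ∈ Set.Icc (p * arcDiff g t₁) (p * arcDiff g t₃),
      HasDerivAt (fun x => slopeNum h (ψ x) / slopeDen h (ψ x) -
        slopeNum g (φ x) / slopeDen g (φ x))
        ((slopeRate h (ψ x) - slopeRate g (φ x)) / x) x ∧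
      (slopeNum h (ψ x) / slopeDen h (ψ x) - slopeNum g (φ x) / slopeDen g (φ x) = 0 →
        (slopeRate h (ψ x) - slopeRate g (φ x)) / x < 0) := by
    intro x hx
    obtain ⟨t, r, ht, hr, htx, hrx⟩ := hex x hx
    obtain ⟨a1, -, a2⟩ := hφ t ht
    obtain ⟨b1, -, b2⟩ := hψ r hr
    rw [htx] at a1 a2
    rw [hrx] at b1 b2
    rw [a1, b1]
    have hx0 : 0 < x := htx ▸ mul_pos hp (arcDiff_pos hg ht)
    refine ⟨(b2.sub a2).congr_deriv (by ring), fun h0 => ?_⟩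
    have := slopeRate_lt hg hgh ht hr (sub_eq_zero.1 h0).symm
    exact div_neg_of_neg_of_pos (by linarith) hx0
  have hval : ∀ {t r}, 0 < t → 0 < r → p * arcDiff g t = q * arcDiff h r →
      p * arcSum g t = q * arcSum h r + k →
      p * arcSum g (φ (p * arcDiff g t)) - q * arcSum h (ψ (p * arcDiff g t)) = k := by
    intro t r ht hr hd hs
    rw [(hφ t ht).1, hd, (hψ r hr).1]
    linarith
  have hv₁ := hval ht₁ hr₁ hd₁ hs₁
  have hv₂ := hval ht₂ hr₂ hd₂ hs₂
  have hv₃ := hval ht₃ hr₃ hd₃ hs₃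
  obtain ⟨ξ, hξ, hξ0⟩ := exists_hasDerivAt_eq_zero hX12
    (fun x hx => (hΨ x ⟨hx.1, hx.2.trans hX23.le⟩).continuousAt.continuousWithinAt)
    (hv₁.trans hv₂.symm) (fun x hx => hΨ x ⟨hx.1.le, (hx.2.trans hX23).le⟩)
  obtain ⟨η, hη, hη0⟩ := exists_hasDerivAt_eq_zero hX23
    (fun x hx => (hΨ x ⟨hX12.le.trans hx.1, hx.2⟩).continuousAt.continuousWithinAt)
    (hv₂.trans hv₃.symm) (fun x hx => hΨ x ⟨(hX12.trans hx.1).le, hx.2.le⟩)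
  have hsub : ∀ x ∈ Set.Icc ξ η, x ∈ Set.Icc (p * arcDiff g t₁) (p * arcDiff g t₃) :=
    fun x hx => ⟨hξ.1.le.trans hx.1, hx.2.trans hη.2.le⟩
  exact zero_unique_of_deriv_neg_at_zeros (hξ.2.trans hη.1)
    (fun x hx => (hZ x (hsub x hx)).1) (fun x hx => (hZ x (hsub x hx)).2) hξ0 hη0

end Real

/-! Arcs of a linear node in a half-plane. -/

/-- `y₀` and `y₁` are the ordinates at which an arc of duration `t` in the half-plane `x < 0` of a
node with parameters `g`, `α` leaves and reaches the line `x = 0`. -/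
def NodeArc (g α t y₀ y₁ : ℝ) : Prop :=
  α / (g + 1) - y₁ = (α / (g + 1) - y₀) * Real.exp ((g + 1) * t) ∧
  α / (g - 1) - y₁ = (α / (g - 1) - y₀) * Real.exp ((g - 1) * t)

namespace NodeArc

variable {g α t t' y₀ y₁ y₀' y₁' : ℝ}

lemma sub_add_eq (h : NodeArc g α t y₀ y₁) (hg : 1 < g) (ht : 0 < t) :
    y₀ - y₁ = α * Real.arcDiff g t ∧ y₀ + y₁ = α * Real.arcSum g t := by
  obtain ⟨h1, h2⟩ := h
  have hg1 : g - 1 ≠ 0 := by linarith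
  have hg2 : g + 1 ≠ 0 := by linarith
  have hg3 : 0 < g ^ 2 - 1 := Real.sq_sub_one_pos hg
  have hs := Real.sinh_pos_iff.2 ht
  have hX := Real.exp_pos (g * t)
  have hY := Real.exp_pos t
  have e1 : Real.exp ((g + 1) * t) = Real.exp (g * t) * Real.exp t := by
    rw [← Real.exp_add]
    ring_nf
  have e2 : Real.exp ((g - 1) * t) = Real.exp (g * t) / Real.exp t := by
    rw [← Real.exp_sub]
    ring_nf
  rw [e1] at h1
  rw [e2] at h2
  have hY1 : 1 < Real.exp t := Real.one_lt_exp_iff.2 ht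
  have hY2 : Real.exp t ^ 2 - 1 ≠ 0 := by nlinarith
  rw [Real.arcDiff, Real.arcSum, Real.sinh_eq, Real.sinh_eq, Real.cosh_eq, Real.cosh_eq,
    Real.exp_neg, Real.exp_neg]
  generalize Real.exp (g * t) = X at *
  generalize Real.exp t = Y at *
  field_simp at h1 h2
  have k0 : y₀ * ((g ^ 2 - 1) * (X * (Y ^ 2 - 1))) =
      α * ((X * Y - 1) * Y * (g - 1) - (X - Y) * (g + 1)) := by
    linear_combination Y * (g - 1) * h1 - (g + 1) * h2
  have k1 : y₁ * ((g ^ 2 - 1) * (Y ^ 2 - 1)) =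
      α * ((X * Y - 1) * (g - 1) - Y * (X - Y) * (g + 1)) := by
    linear_combination (g - 1) * h1 - Y * (g + 1) * h2
  have hg3' := hg3.ne'
  constructor
  · field_simp
    linear_combination k0 - X * k1
  · field_simp
    linear_combination k0 + X * k1

/-- Up to the factor `α / 2` these are `y₀` and `-y₁`; monotonicity follows from the slope of sum
against difference lying in `(-1, 0)`. -/
lemma monotone_aux (hg : 1 < g) :
    StrictMonoOn (fun t => Real.arcDiff g t + Real.arcSum g t) (Set.Ioi 0) ∧
    StrictMonoOn (fun t => Real.arcDiff g t - Real.arcSum g t) (Set.Ioi 0) := by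
  have h1 : ∀ t, 0 < t → 0 < 2 * Real.slopeDen g t / ((g ^ 2 - 1) * Real.sinh t ^ 2) -
      2 * Real.slopeNum g t / ((g ^ 2 - 1) * Real.sinh t ^ 2) := by
    intro t ht
    have := Real.slopeNum_lt_slopeDen hg ht
    have := Real.sinh_pos_iff.2 ht
    have := Real.sq_sub_one_pos hg
    rw [← sub_div]
    exact div_pos (by linarith) (by positivity)
  have h2 : ∀ t, 0 < t → 0 < 2 * Real.slopeNum g t / ((g ^ 2 - 1) * Real.sinh t ^ 2) := by
    intro t ht
    have := Real.slopeNum_pos hg ht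
    have := Real.sinh_pos_iff.2 ht
    have := Real.sq_sub_one_pos hg
    positivity
  constructor
  · apply strictMonoOn_of_hasDerivWithinAt_pos (convex_Ioi 0)
      (fun t ht => ((Real.hasDerivAt_arcDiff hg ht).add
        (Real.hasDerivAt_arcSum hg ht)).continuousAt.continuousWithinAt)
      (fun t ht => ((Real.hasDerivAt_arcDiff hg (interior_subset ht)).add
        (Real.hasDerivAt_arcSum hg (interior_subset ht))).hasDerivWithinAt)
    intro t ht
    have := h1 t (interior_subset ht)
    linarith
  · apply strictMonoOn_of_hasDerivWithinAt_pos (convex_Ioi 0)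
      (fun t ht => ((Real.hasDerivAt_arcDiff hg ht).sub
        (Real.hasDerivAt_arcSum hg ht)).continuousAt.continuousWithinAt)
      (fun t ht => ((Real.hasDerivAt_arcDiff hg (interior_subset ht)).sub
        (Real.hasDerivAt_arcSum hg (interior_subset ht))).hasDerivWithinAt)
    intro t ht
    have := h1 t (interior_subset ht)
    have := h2 t (interior_subset ht)
    linarith

lemma time_le_iff (h : NodeArc g α t y₀ y₁) (h' : NodeArc g α t' y₀' y₁') (hg : 1 < g)
    (hα : 0 < α) (ht : 0 < t) (ht' : 0 < t') :
    (t ≤ t' ↔ y₀ ≤ y₀') ∧ (t ≤ t' ↔ y₁' ≤ y₁) := by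
  obtain ⟨m1, m2⟩ := monotone_aux hg
  obtain ⟨a1, a2⟩ := h.sub_add_eq hg ht
  obtain ⟨b1, b2⟩ := h'.sub_add_eq hg ht'
  constructor
  · rw [← m1.le_iff_le ht ht', ← mul_le_mul_iff_right₀ hα]
    simp only [mul_add]
    rw [← a1, ← a2, ← b1, ← b2]
    constructor <;> intro <;> linarith
  · rw [← m2.le_iff_le ht ht', ← mul_le_mul_iff_right₀ hα]
    simp only [mul_sub]
    rw [← a1, ← a2, ← b1, ← b2]
    constructor <;> intro <;> linarith

/-- Arcs of one node are nested: the reached ordinate decreases with the initial one. -/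
lemma le_iff (h : NodeArc g α t y₀ y₁) (h' : NodeArc g α t' y₀' y₁') (hg : 1 < g)
    (hα : 0 < α) (ht : 0 < t) (ht' : 0 < t') : y₀ ≤ y₀' ↔ y₁' ≤ y₁ := by
  obtain ⟨a, b⟩ := h.time_le_iff h' hg hα ht ht'
  rw [← a, b]

end NodeArc

/-- The row `(l, -1)` is a left eigenvector of the matrix for the eigenvalue `l`, and the constant
`β + α / l` absorbs the inhomogeneous term. -/
lemma hasDerivAt_nodeField_eigen {γ α β l t : ℝ} {c : ℝ → ℝ × ℝ}
    (hl : l ^ 2 = 2 * γ * l - (γ ^ 2 - 1)) (hl0 : l ≠ 0)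
    (hc : HasDerivAt c (nodeField γ α β (c t)) t) :
    HasDerivAt (fun t => (l * (c t).1 - (c t).2 + β + α / l) * Real.exp (-(l * t))) 0 t := by
  have h1 : HasDerivAt (fun t => (c t).1) _ t := hasFDerivAt_fst.comp_hasDerivAt t hc
  have h2 : HasDerivAt (fun t => (c t).2) _ t := hasFDerivAt_snd.comp_hasDerivAt t hc
  refine ((((((h1.const_mul l).sub h2).add_const β).add_const (α / l))).mul
    ((hasDerivAt_id' t).const_mul l).neg.exp).congr_deriv ?_
  simp [nodeField]
  field_simp
  linear_combination (-(c t).1 * Real.exp (-(l * t))) * hl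

/-- Explicit solution of the node in eigencoordinates. -/
lemma nodeField_eigen_eq {γ α β l a b : ℝ} {c : ℝ → ℝ × ℝ}
    (hl : l ^ 2 = 2 * γ * l - (γ ^ 2 - 1)) (hl0 : l ≠ 0) (hcont : Continuous c)
    (hc : ∀ s ∈ Set.Ioo a b, HasDerivAt c (nodeField γ α β (c s)) s) {s : ℝ}
    (hs : s ∈ Set.Icc a b) :
    l * (c s).1 - (c s).2 + β + α / l =
      (l * (c a).1 - (c a).2 + β + α / l) * Real.exp (l * (s - a)) := by
  rcases hs.1.eq_or_lt with rfl | has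
  · simp
  obtain ⟨ξ, -, hξ⟩ := exists_hasDerivAt_eq_slope
    (fun t => (l * (c t).1 - (c t).2 + β + α / l) * Real.exp (-(l * t))) (fun _ => 0) has
    (by fun_prop) (fun x hx => hasDerivAt_nodeField_eigen hl hl0 (hc x ⟨hx.1, hx.2.trans_le hs.2⟩))
  have h1 : s - a ≠ 0 := by linarith
  have hξ := (div_eq_zero_iff.1 hξ.symm).resolve_right h1
  have h2 : (l * (c s).1 - (c s).2 + β + α / l) * Real.exp (-(l * s)) =
      (l * (c a).1 - (c a).2 + β + α / l) * Real.exp (-(l * a)) := by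
    linarith
  have h3 : Real.exp (l * (s - a)) = Real.exp (-(l * a)) * Real.exp (l * s) := by
    rw [← Real.exp_add]
    ring_nf
  rw [h3, ← mul_assoc, ← h2, mul_assoc, ← Real.exp_add]
  simp

/-- Uniqueness of solutions of the node issuing from a common point. -/
lemma nodeField_unique {γ α β a a' ε : ℝ} {c c' : ℝ → ℝ × ℝ} (hγ : 1 < |γ|)
    (hcont : Continuous c) (hcont' : Continuous c')
    (hc : ∀ s ∈ Set.Ioo a (a + ε), HasDerivAt c (nodeField γ α β (c s)) s)
    (hc' : ∀ s ∈ Set.Ioo a' (a' + ε), HasDerivAt c' (nodeField γ α β (c' s)) s)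
    (h0 : c a = c' a') {u : ℝ} (hu : u ∈ Set.Icc 0 ε) : c (a + u) = c' (a' + u) := by
  have hp : γ + 1 ≠ 0 := by
    rintro h
    rw [show γ = -1 by linarith] at hγ
    simp at hγ
  have hm : γ - 1 ≠ 0 := by
    rintro h
    rw [show γ = 1 by linarith] at hγ
    simp at hγ
  have key : ∀ l, l ^ 2 = 2 * γ * l - (γ ^ 2 - 1) → l ≠ 0 →
      l * (c (a + u)).1 - (c (a + u)).2 = l * (c' (a' + u)).1 - (c' (a' + u)).2 := by
    intro l hl hl0
    have h1 := nodeField_eigen_eq hl hl0 hcont hc (s := a + u)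
      ⟨by linarith [hu.1], by linarith [hu.2]⟩
    have h2 := nodeField_eigen_eq hl hl0 hcont' hc' (s := a' + u)
      ⟨by linarith [hu.1], by linarith [hu.2]⟩
    rw [h0, add_sub_cancel_left] at h1
    rw [add_sub_cancel_left, ← h1] at h2
    linarith
  have k1 := key (γ + 1) (by ring) hp
  have k2 := key (γ - 1) (by ring) hm
  have hx : (c (a + u)).1 = (c' (a' + u)).1 := by linarith
  rw [hx] at k1
  exact Prod.ext hx (by linarith)

/-! Signs of continuous functions. -/

lemma sign_const_of_ne_zero {x : ℝ → ℝ} {a b : ℝ} (hx : Continuous x)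
    (h : ∀ s ∈ Set.Ioo a b, x s ≠ 0) :
    (∀ s ∈ Set.Ioo a b, x s < 0) ∨ (∀ s ∈ Set.Ioo a b, 0 < x s) := by
  by_contra! hc
  obtain ⟨⟨s, hs, hs0⟩, ⟨r, hr, hr0⟩⟩ := hc
  obtain ⟨z, hz, hz0⟩ := isPreconnected_Ioo.intermediate_value hr hs hx.continuousOn ⟨hr0, hs0⟩
  exact h z hz hz0

lemma exists_gt_of_deriv_pos_left {x v : ℝ → ℝ} {a b : ℝ} (hab : a < b) (hx : Continuous x)
    (hv : Continuous v) (hd : ∀ s ∈ Set.Ioo a b, HasDerivAt x (v s) s) (h : 0 < v a) :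
    ∃ s ∈ Set.Ioo a b, x a < x s := by
  have h1 : ∀ᶠ s in 𝓝[>] a, 0 < v s :=
    nhdsWithin_le_nhds (hv.continuousAt.eventually (lt_mem_nhds h))
  obtain ⟨u, hu, hsub⟩ := mem_nhdsGT_iff_exists_Ioo_subset.1 h1
  have hu : a < u := hu
  obtain ⟨w, hw1, hw2⟩ := exists_between (lt_min hab hu)
  have hwb := hw2.trans_le (min_le_left _ _)
  obtain ⟨ξ, hξ, hξ'⟩ := exists_hasDerivAt_eq_slope x v hw1 hx.continuousOn
    (fun s hs => hd s ⟨hs.1, hs.2.trans hwb⟩)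
  have h2 : 0 < v ξ := hsub ⟨hξ.1, hξ.2.trans (hw2.trans_le (min_le_right _ _))⟩
  rw [hξ'] at h2
  refine ⟨w, ⟨hw1, hwb⟩, ?_⟩
  have := (div_pos_iff_of_pos_right (sub_pos.2 hw1)).1 h2
  linarith

lemma exists_lt_of_deriv_neg_left {x v : ℝ → ℝ} {a b : ℝ} (hab : a < b) (hx : Continuous x)
    (hv : Continuous v) (hd : ∀ s ∈ Set.Ioo a b, HasDerivAt x (v s) s) (h : v a < 0) :
    ∃ s ∈ Set.Ioo a b, x s < x a := by
  obtain ⟨s, hs, h⟩ := exists_gt_of_deriv_pos_left hab hx.neg hv.neg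
    (fun s hs => (hd s hs).neg) (neg_pos.2 h)
  exact ⟨s, hs, neg_lt_neg_iff.1 h⟩

lemma exists_gt_of_deriv_neg_right {x v : ℝ → ℝ} {a b : ℝ} (hab : a < b) (hx : Continuous x)
    (hv : Continuous v) (hd : ∀ s ∈ Set.Ioo a b, HasDerivAt x (v s) s) (h : v b < 0) :
    ∃ s ∈ Set.Ioo a b, x b < x s := by
  obtain ⟨s, hs, h⟩ := exists_gt_of_deriv_pos_left (x := fun s => x (-s)) (v := fun s => -v (-s))
    (neg_lt_neg hab) (hx.comp continuous_neg) (hv.comp continuous_neg).neg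
    (fun s hs => by
      have := (hd (-s) ⟨by linarith [hs.2], by linarith [hs.1]⟩).comp s (hasDerivAt_neg s)
      exact this.congr_deriv (by ring)) (by simpa using h)
  exact ⟨-s, ⟨by linarith [hs.2], by linarith [hs.1]⟩, by simpa using h⟩

lemma exists_lt_of_deriv_pos_right {x v : ℝ → ℝ} {a b : ℝ} (hab : a < b) (hx : Continuous x)
    (hv : Continuous v) (hd : ∀ s ∈ Set.Ioo a b, HasDerivAt x (v s) s) (h : 0 < v b) :
    ∃ s ∈ Set.Ioo a b, x s < x b := by
  obtain ⟨s, hs, h⟩ := exists_gt_of_deriv_neg_right hab hx.neg hv.neg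
    (fun s hs => (hd s hs).neg) (neg_lt_zero.2 h)
  exact ⟨s, hs, neg_lt_neg_iff.1 h⟩

/-! ### Crossing solutions, their uniqueness and their arcs -/

namespace IsCrossingPeriodicSolution

section General

variable {F G : ℝ × ℝ → ℝ × ℝ} {T : ℝ} {c : ℝ → ℝ × ℝ}

lemma continuous_fst (hc : IsCrossingPeriodicSolution F G T c) : Continuous fun t => (c t).1 :=
  hc.continuous.fst

lemma hasDerivAt_fst_left (hc : IsCrossingPeriodicSolution F G T c) {t : ℝ} (ht : (c t).1 < 0) :
    HasDerivAt (fun t => (c t).1) (F (c t)).1 t :=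
  have h : HasDerivAt (fun t => (c t).1) _ t := hasFDerivAt_fst.comp_hasDerivAt t (hc.left t ht)
  h

lemma hasDerivAt_fst_right (hc : IsCrossingPeriodicSolution F G T c) {t : ℝ}
    (ht : 0 < (c t).1) : HasDerivAt (fun t => (c t).1) (G (c t)).1 t :=
  have h : HasDerivAt (fun t => (c t).1) _ t := hasFDerivAt_fst.comp_hasDerivAt t (hc.right t ht)
  h

lemma exists_Ioo_right (hc : IsCrossingPeriodicSolution F G T c) (t : ℝ) :
    ∃ u, t < u ∧ ∀ s ∈ Set.Ioo t u, (c s).1 ≠ 0 := by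
  have : ∀ᶠ s in 𝓝[>] t, (c s).1 ≠ 0 := by
    by_cases h : (c t).1 = 0
    · exact (hc.isolated t h).filter_mono (nhdsWithin_mono _ fun y hy => ne_of_gt hy)
    · exact nhdsWithin_le_nhds (hc.continuous_fst.continuousAt.eventually_ne h)
  obtain ⟨u, hu, hsub⟩ := mem_nhdsGT_iff_exists_Ioo_subset.1 this
  exact ⟨u, hu, fun s hs => hsub hs⟩

lemma exists_Ioo_left (hc : IsCrossingPeriodicSolution F G T c) {t : ℝ} (h : (c t).1 = 0) :
    ∃ u, u < t ∧ ∀ s ∈ Set.Ioo u t, (c s).1 ≠ 0 := by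
  have : ∀ᶠ s in 𝓝[<] t, (c s).1 ≠ 0 :=
    (hc.isolated t h).filter_mono (nhdsWithin_mono _ fun y hy => ne_of_lt hy)
  obtain ⟨u, hu, hsub⟩ := mem_nhdsLT_iff_exists_Ioo_subset.1 this
  exact ⟨u, hu, fun s hs => hsub hs⟩

lemma exists_next_zero (hc : IsCrossingPeriodicSolution F G T c) {t : ℝ} (h : (c t).1 = 0) :
    ∃ t', t < t' ∧ (c t').1 = 0 ∧ ∀ s ∈ Set.Ioo t t', (c s).1 ≠ 0 := by
  obtain ⟨u, hu, hne⟩ := hc.exists_Ioo_right t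
  have hT := hc.period_pos
  have hz : (c (t + T)).1 = 0 := by rw [hc.periodic t, h]
  have huT : u ≤ t + T := by
    by_contra! hlt
    exact hne _ ⟨by linarith, hlt⟩ hz
  obtain ⟨t', ht', hmin⟩ := (isCompact_Icc.inter_right
    (isClosed_singleton.preimage hc.continuous_fst)).exists_isLeast
    (s := Set.Icc u (t + T) ∩ (fun t => (c t).1) ⁻¹' {0}) ⟨t + T, ⟨huT, le_rfl⟩, hz⟩
  refine ⟨t', hu.trans_le ht'.1.1, ht'.2, fun s hs h0 => ?_⟩
  rcases lt_or_ge s u with hsu | hsu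
  · exact hne s ⟨hs.1, hsu⟩ h0
  · exact absurd (hmin ⟨⟨hsu, (hs.2.trans_le ht'.1.2).le⟩, h0⟩) (not_le.2 hs.2)

lemma exists_prev_zero (hc : IsCrossingPeriodicSolution F G T c) {t : ℝ} (h : (c t).1 = 0) :
    ∃ t', t' < t ∧ (c t').1 = 0 ∧ ∀ s ∈ Set.Ioo t' t, (c s).1 ≠ 0 := by
  obtain ⟨u, hu, hne⟩ := hc.exists_Ioo_left h
  have hT := hc.period_pos
  have hz : (c (t - T)).1 = 0 := by rw [hc.periodic.sub_eq t, h]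
  have huT : t - T ≤ u := by
    by_contra! hlt
    exact hne _ ⟨hlt, by linarith⟩ hz
  obtain ⟨t', ht', hmax⟩ := (isCompact_Icc.inter_right
    (isClosed_singleton.preimage hc.continuous_fst)).exists_isGreatest
    (s := Set.Icc (t - T) u ∩ (fun t => (c t).1) ⁻¹' {0}) ⟨t - T, ⟨le_rfl, huT⟩, hz⟩
  refine ⟨t', ht'.1.2.trans_lt hu, ht'.2, fun s hs h0 => ?_⟩
  rcases lt_or_ge u s with hsu | hsu
  · exact hne s ⟨hsu, hs.2⟩ h0
  · exact absurd (hmax ⟨⟨(ht'.1.1.trans_lt hs.1).le, hsu⟩, h0⟩) (not_le.2 hs.1)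

end General

variable {γL γR αL αR b T T' : ℝ} {c c' : ℝ → ℝ × ℝ}

/-- On `x = 0` the two first components are `-y` and `b - y`, with product `y * (y - b)`. -/
lemma crossing_cases (hc : IsCrossingPeriodicSolution (nodeField γL αL 0) (nodeField γR αR b) T c)
    {t : ℝ} (h : (c t).1 = 0) : (c t).2 < 0 ∨ b < (c t).2 := by
  have := hc.crossing t h
  simp only [nodeField, h] at this
  by_contra! hcon
  nlinarith [mul_nonneg hcon.1 (sub_nonneg.2 hcon.2)]

lemma continuous_fieldFst (hc : Continuous c) (γ α β : ℝ) :
    Continuous fun t => (nodeField γ α β (c t)).1 := by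
  simp only [nodeField]
  fun_prop

lemma departs_left (hc : IsCrossingPeriodicSolution (nodeField γL αL 0) (nodeField γR αR b) T c)
    {t u : ℝ} (htu : t < u) (h : (c t).1 = 0)
    (hneg : ∀ s ∈ Set.Ioo t u, (c s).1 < 0) : b < (c t).2 := by
  refine (hc.crossing_cases h).resolve_left fun hy => ?_
  obtain ⟨s, hs, hlt⟩ := exists_gt_of_deriv_pos_left htu hc.continuous_fst
    (continuous_fieldFst hc.continuous γL αL 0)
    (fun s hs => hc.hasDerivAt_fst_left (hneg s hs)) (by simp [nodeField, h, hy])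
  have := hneg s hs
  rw [h] at hlt
  linarith

lemma departs_right (hc : IsCrossingPeriodicSolution (nodeField γL αL 0) (nodeField γR αR b) T c)
    {t u : ℝ} (htu : t < u) (h : (c t).1 = 0)
    (hpos : ∀ s ∈ Set.Ioo t u, 0 < (c s).1) : (c t).2 < 0 := by
  refine (hc.crossing_cases h).resolve_right fun hy => ?_
  obtain ⟨s, hs, hlt⟩ := exists_lt_of_deriv_neg_left htu hc.continuous_fst
    (continuous_fieldFst hc.continuous γR αR b)
    (fun s hs => hc.hasDerivAt_fst_right (hpos s hs)) (by simp [nodeField, h, hy])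
  have := hpos s hs
  rw [h] at hlt
  linarith

lemma arrives_left (hc : IsCrossingPeriodicSolution (nodeField γL αL 0) (nodeField γR αR b) T c)
    (hb : 0 < b) {t u : ℝ} (htu : u < t) (h : (c t).1 = 0)
    (hneg : ∀ s ∈ Set.Ioo u t, (c s).1 < 0) : (c t).2 < 0 := by
  refine (hc.crossing_cases h).resolve_right fun hy => ?_
  obtain ⟨s, hs, hlt⟩ := exists_gt_of_deriv_neg_right htu hc.continuous_fst
    (continuous_fieldFst hc.continuous γL αL 0)
    (fun s hs => hc.hasDerivAt_fst_left (hneg s hs)) (by simp [nodeField, h, hb.trans hy])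
  have := hneg s hs
  rw [h] at hlt
  linarith

lemma arrives_right (hc : IsCrossingPeriodicSolution (nodeField γL αL 0) (nodeField γR αR b) T c)
    (hb : 0 < b) {t u : ℝ} (htu : u < t) (h : (c t).1 = 0)
    (hpos : ∀ s ∈ Set.Ioo u t, 0 < (c s).1) : b < (c t).2 := by
  refine (hc.crossing_cases h).resolve_left fun hy => ?_
  obtain ⟨s, hs, hlt⟩ := exists_lt_of_deriv_pos_right htu hc.continuous_fst
    (continuous_fieldFst hc.continuous γR αR b)
    (fun s hs => hc.hasDerivAt_fst_right (hpos s hs)) (by simp [nodeField, h]; linarith)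
  have := hpos s hs
  rw [h] at hlt
  linarith

/-- The side entered by a crossing solution is determined by its current position. -/
lemma forward_side (hc : IsCrossingPeriodicSolution (nodeField γL αL 0) (nodeField γR αR b) T c)
    (hb : 0 < b) (t : ℝ) :
    (((c t).1 < 0 ∨ (c t).1 = 0 ∧ b < (c t).2) ∧ ∃ u, t < u ∧ ∀ s ∈ Set.Ioo t u, (c s).1 < 0) ∨
    (¬((c t).1 < 0 ∨ (c t).1 = 0 ∧ b < (c t).2) ∧
      ∃ u, t < u ∧ ∀ s ∈ Set.Ioo t u, 0 < (c s).1) := by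
  obtain ⟨u, hu, hne⟩ := hc.exists_Ioo_right t
  have hx := hc.continuous_fst
  have hlim : Tendsto (fun s => (c s).1) (𝓝[>] t) (𝓝 (c t).1) :=
    hx.continuousAt.tendsto.mono_left nhdsWithin_le_nhds
  rcases sign_const_of_ne_zero hx hne with h | h
  · refine Or.inl ⟨?_, u, hu, h⟩
    have hle : (c t).1 ≤ 0 := le_of_tendsto hlim
      (mem_of_superset (Ioo_mem_nhdsGT hu) fun s hs => (h s hs).le)
    rcases hle.lt_or_eq with h0 | h0
    · exact Or.inl h0
    · exact Or.inr ⟨h0, hc.departs_left hu h0 h⟩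
  · refine Or.inr ⟨?_, u, hu, h⟩
    have hle : 0 ≤ (c t).1 := ge_of_tendsto hlim
      (mem_of_superset (Ioo_mem_nhdsGT hu) fun s hs => (h s hs).le)
    rintro (h0 | ⟨h0, h1⟩)
    · linarith
    · linarith [hc.departs_right hu h0 h]

/-- Forward uniqueness of crossing solutions. -/
lemma forward_unique
    (hc : IsCrossingPeriodicSolution (nodeField γL αL 0) (nodeField γR αR b) T c)
    (hc' : IsCrossingPeriodicSolution (nodeField γL αL 0) (nodeField γR αR b) T' c')
    (hL : 1 < |γL|) (hR : 1 < |γR|) (hb : 0 < b) {t t' : ℝ} (h : c t = c' t') {u : ℝ}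
    (hu : 0 ≤ u) : c (t + u) = c' (t' + u) := by
  -- Agreement is a closed condition, and it propagates to the right because equal positions force
  -- both solutions into the same half-plane, where the linear flow is unique.
  have hclosed : IsClosed ({u | c (t + u) = c' (t' + u)} ∩ Set.Icc 0 u) :=
    (isClosed_eq (hc.continuous.comp (by fun_prop)) (hc'.continuous.comp (by fun_prop))).inter
      isClosed_Icc
  refine hclosed.Icc_subset_of_forall_mem_nhdsWithin (by simpa using h) (fun v hv => ?_)
    ⟨hu, le_rfl⟩
  have hv : c (t + v) = c' (t' + v) := hv.1
  have key : ∀ {γ α β u₁ u₂ : ℝ}, 1 < |γ| → t + v < u₁ → t' + v < u₂ →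
      (∀ s ∈ Set.Ioo (t + v) u₁, HasDerivAt c (nodeField γ α β (c s)) s) →
      (∀ s ∈ Set.Ioo (t' + v) u₂, HasDerivAt c' (nodeField γ α β (c' s)) s) →
      {u | c (t + u) = c' (t' + u)} ∈ 𝓝[>] v := by
    intro γ α β u₁ u₂ hγ h1 h2 hd1 hd2
    obtain ⟨ε, hε, hε1, hε2⟩ : ∃ ε, 0 < ε ∧ t + v + ε ≤ u₁ ∧ t' + v + ε ≤ u₂ :=
      ⟨min (u₁ - (t + v)) (u₂ - (t' + v)), lt_min (by linarith) (by linarith),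
        by linarith [min_le_left (u₁ - (t + v)) (u₂ - (t' + v))],
        by linarith [min_le_right (u₁ - (t + v)) (u₂ - (t' + v))]⟩
    refine mem_of_superset (Ioo_mem_nhdsGT (show v < v + ε by linarith)) fun s hs => ?_
    have := nodeField_unique (ε := ε) (u := s - v) hγ hc.continuous hc'.continuous
      (fun s hs => hd1 s ⟨hs.1, hs.2.trans_le hε1⟩) (fun s hs => hd2 s ⟨hs.1, hs.2.trans_le hε2⟩)
      hv ⟨by linarith [hs.1], by linarith [hs.2]⟩
    simpa [add_assoc] using this
  rcases hc.forward_side hb (t + v) with ⟨h1, u₁, hu₁, hs₁⟩ | ⟨h1, u₁, hu₁, hs₁⟩ <;>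
  rcases hc'.forward_side hb (t' + v) with ⟨h2, u₂, hu₂, hs₂⟩ | ⟨h2, u₂, hu₂, hs₂⟩
  · exact key hL hu₁ hu₂ (fun s hs => hc.left s (hs₁ s hs)) (fun s hs => hc'.left s (hs₂ s hs))
  · exact absurd (hv ▸ h1) h2
  · exact absurd (hv ▸ h2) h1
  · exact key hR hu₁ hu₂ (fun s hs => hc.right s (hs₁ s hs)) (fun s hs => hc'.right s (hs₂ s hs))

lemma range_subset_of_eq
    (hc : IsCrossingPeriodicSolution (nodeField γL αL 0) (nodeField γR αR b) T c)
    (hc' : IsCrossingPeriodicSolution (nodeField γL αL 0) (nodeField γR αR b) T' c')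
    (hL : 1 < |γL|) (hR : 1 < |γR|) (hb : 0 < b) {t t' : ℝ} (h : c t = c' t') :
    Set.range c ⊆ Set.range c' := by
  rintro _ ⟨s, rfl⟩
  -- Periodicity moves any time past `t`, so forward uniqueness is enough.
  obtain ⟨n, hn⟩ := exists_nat_ge ((t - s) / T)
  rw [div_le_iff₀ hc.period_pos] at hn
  refine ⟨t' + (s + n * T - t), ?_⟩
  rw [← hc.forward_unique hc' hL hR hb h (by linarith), add_sub_cancel]
  exact hc.periodic.nat_mul n s

/-- Two crossing periodic orbits with a common point coincide. -/
lemma range_eq_of_eq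
    (hc : IsCrossingPeriodicSolution (nodeField γL αL 0) (nodeField γR αR b) T c)
    (hc' : IsCrossingPeriodicSolution (nodeField γL αL 0) (nodeField γR αR b) T' c')
    (hL : 1 < |γL|) (hR : 1 < |γR|) (hb : 0 < b) {t t' : ℝ} (h : c t = c' t') :
    Set.range c = Set.range c' :=
  (hc.range_subset_of_eq hc' hL hR hb h).antisymm (hc'.range_subset_of_eq hc hL hR hb h.symm)

lemma nodeArc_left
    (hc : IsCrossingPeriodicSolution (nodeField γL αL 0) (nodeField γR αR b) T c)
    (hL : 1 < γL) {t t' : ℝ} (htt' : t < t') (h : (c t).1 = 0) (h' : (c t').1 = 0)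
    (hneg : ∀ s ∈ Set.Ioo t t', (c s).1 < 0) :
    NodeArc γL αL (t' - t) (c t).2 (c t').2 := by
  have key : ∀ l, l ^ 2 = 2 * γL * l - (γL ^ 2 - 1) → l ≠ 0 →
      αL / l - (c t').2 = (αL / l - (c t).2) * Real.exp (l * (t' - t)) := by
    intro l hl hl0
    have := nodeField_eigen_eq hl hl0 hc.continuous (fun s hs => hc.left s (hneg s hs))
      (s := t') ⟨htt'.le, le_rfl⟩
    rw [h, h'] at this
    linarith
  exact ⟨key _ (by ring) (by linarith), key _ (by ring) (by linarith)⟩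

/-- The map `(x, y, t) ↦ (-x, y - b, -t)` carries the right subsystem to a left one with parameters
`-γR`, `-αR`; time reversal is why the final ordinate comes first. -/
lemma nodeArc_right
    (hc : IsCrossingPeriodicSolution (nodeField γL αL 0) (nodeField γR αR b) T c)
    (hR : γR < -1) {t t' : ℝ} (htt' : t < t') (h : (c t).1 = 0) (h' : (c t').1 = 0)
    (hpos : ∀ s ∈ Set.Ioo t t', 0 < (c s).1) :
    NodeArc (-γR) (-αR) (t' - t) ((c t').2 - b) ((c t).2 - b) := by
  have key : ∀ l, l ^ 2 = 2 * γR * (-l) - (γR ^ 2 - 1) → l ≠ 0 →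
      -αR / l - ((c t).2 - b) = (-αR / l - ((c t').2 - b)) * Real.exp (l * (t' - t)) := by
    intro l hl hl0
    have := nodeField_eigen_eq (l := -l) (by linarith) (neg_ne_zero.2 hl0) hc.continuous
      (fun s hs => hc.right s (hpos s hs)) (s := t') ⟨htt'.le, le_rfl⟩
    rw [h, h'] at this
    have e : Real.exp (-l * (t' - t)) * Real.exp (l * (t' - t)) = 1 := by
      rw [← Real.exp_add]
      simp
    have e2 : αR / -l = -αR / l := by rw [div_neg, neg_div]
    rw [e2] at this
    linear_combination (-Real.exp (l * (t' - t))) * this +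
      ((c t).2 - b + αR / l) * e
  exact ⟨key _ (by ring) (by linarith), key _ (by ring) (by linarith)⟩

section Successor

variable {t : ℝ}

lemma exists_next_left
    (hc : IsCrossingPeriodicSolution (nodeField γL αL 0) (nodeField γR αR b) T c)
    (hL : 1 < γL) (hb : 0 < b) (h : (c t).1 = 0) (hy : b < (c t).2) :
    ∃ t', t < t' ∧ (c t').1 = 0 ∧ (c t').2 < 0 ∧ NodeArc γL αL (t' - t) (c t).2 (c t').2 := by
  obtain ⟨t', htt', h', hne⟩ := hc.exists_next_zero h
  rcases sign_const_of_ne_zero hc.continuous_fst hne with hs | hs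
  · exact ⟨t', htt', h', hc.arrives_left hb htt' h' hs, hc.nodeArc_left hL htt' h h' hs⟩
  · linarith [hc.departs_right htt' h hs]

lemma exists_next_right
    (hc : IsCrossingPeriodicSolution (nodeField γL αL 0) (nodeField γR αR b) T c)
    (hR : γR < -1) (hb : 0 < b) (h : (c t).1 = 0) (hy : (c t).2 < 0) :
    ∃ t', t < t' ∧ (c t').1 = 0 ∧ b < (c t').2 ∧
      NodeArc (-γR) (-αR) (t' - t) ((c t').2 - b) ((c t).2 - b) := by
  obtain ⟨t', htt', h', hne⟩ := hc.exists_next_zero h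
  rcases sign_const_of_ne_zero hc.continuous_fst hne with hs | hs
  · linarith [hc.departs_left htt' h hs]
  · exact ⟨t', htt', h', hc.arrives_right hb htt' h' hs, hc.nodeArc_right hR htt' h h' hs⟩

lemma exists_prev_left
    (hc : IsCrossingPeriodicSolution (nodeField γL αL 0) (nodeField γR αR b) T c)
    (hL : 1 < γL) (hb : 0 < b) (h : (c t).1 = 0) (hy : (c t).2 < 0) :
    ∃ t', t' < t ∧ (c t').1 = 0 ∧ b < (c t').2 ∧ NodeArc γL αL (t - t') (c t').2 (c t).2 := by
  obtain ⟨t', htt', h', hne⟩ := hc.exists_prev_zero h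
  rcases sign_const_of_ne_zero hc.continuous_fst hne with hs | hs
  · exact ⟨t', htt', h', hc.departs_left htt' h' hs, hc.nodeArc_left hL htt' h' h hs⟩
  · linarith [hc.arrives_right hb htt' h hs]

lemma exists_prev_right
    (hc : IsCrossingPeriodicSolution (nodeField γL αL 0) (nodeField γR αR b) T c)
    (hR : γR < -1) (hb : 0 < b) (h : (c t).1 = 0) (hy : b < (c t).2) :
    ∃ t', t' < t ∧ (c t').1 = 0 ∧ (c t').2 < 0 ∧
      NodeArc (-γR) (-αR) (t - t') ((c t).2 - b) ((c t').2 - b) := by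
  obtain ⟨t', htt', h', hne⟩ := hc.exists_prev_zero h
  rcases sign_const_of_ne_zero hc.continuous_fst hne with hs | hs
  · linarith [hc.arrives_left hb htt' h hs]
  · exact ⟨t', htt', h', hc.departs_right htt' h' hs, hc.nodeArc_right hR htt' h' h hs⟩

end Successor

/-- Every crossing periodic orbit closes up after one arc on each side. -/
lemma exists_closed_arcs
    (hc : IsCrossingPeriodicSolution (nodeField γL αL 0) (nodeField γR αR b) T c)
    (hL : 1 < γL) (hR : γR < -1) (hαL : 0 < αL) (hαR : αR < 0) (hb : 0 < b) :
    ∃ τ y₀ y₁ t r : ℝ, c τ = (0, y₀) ∧ 0 < t ∧ 0 < r ∧ NodeArc γL αL t y₀ y₁ ∧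
      NodeArc (-γR) (-αR) r (y₀ - b) (y₁ - b) := by
  have hT := hc.period_pos
  have hzero : ∀ t, (c t).1 = 0 →
      ∃ s ∈ Set.Icc 0 T ∩ (fun t => (c t).1) ⁻¹' {0}, c s = c t := by
    intro t ht
    obtain ⟨s, hs, hst⟩ := hc.periodic.exists_mem_Ico₀ hT t
    exact ⟨s, ⟨⟨hs.1, hs.2.le⟩, by simp [← hst, ht]⟩, hst.symm⟩
  obtain ⟨t₀, ht₀⟩ := hc.meets
  obtain ⟨s₀, hs₀, -⟩ := hzero t₀ ht₀
  -- The orbit is based at its highest crossing. It exists because one period of zeros is compact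
  -- and carries all crossing points.
  obtain ⟨τ, hτ, hmax⟩ := (isCompact_Icc.inter_right
    (isClosed_singleton.preimage hc.continuous_fst)).exists_isMaxOn
    (s := Set.Icc 0 T ∩ (fun t => (c t).1) ⁻¹' {0}) ⟨s₀, hs₀⟩
    (f := fun t => (c t).2) hc.continuous.snd.continuousOn
  have hmax' : ∀ t, (c t).1 = 0 → (c t).2 ≤ (c τ).2 := by
    intro t ht
    obtain ⟨s, hs, hst⟩ := hzero t ht
    rw [← hst]
    exact hmax hs
  have hτ0 : (c τ).1 = 0 := hτ.2
  have hy : b < (c τ).2 := by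
    rcases hc.crossing_cases hτ0 with h | h
    · obtain ⟨t', -, h0, h1, -⟩ := hc.exists_next_right hR hb hτ0 h
      exact h1.trans_le (hmax' t' h0)
    · exact h
  obtain ⟨t₁, ht₁, hz₁, hy₁, ha₁⟩ := hc.exists_next_left hL hb hτ0 hy
  obtain ⟨t₂, ht₂, hz₂, -, ha₂⟩ := hc.exists_next_right hR hb hz₁ hy₁
  obtain ⟨u₁, hu₁, hw₁, hv₁, hb₁⟩ := hc.exists_prev_right hR hb hτ0 hy
  obtain ⟨u₂, hu₂, hw₂, -, hb₂⟩ := hc.exists_prev_left hL hb hw₁ hv₁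
  -- Two arcs backward from the highest crossing start no higher. Nesting on the left, then on the
  -- right, shows that two arcs forward end no lower; maximality gives equality.
  have e1 := (hb₂.le_iff ha₁ hL hαL (by linarith) (by linarith)).1 (hmax' u₂ hw₂)
  have e2 := (hb₁.le_iff ha₂ (by linarith) (by linarith) (by linarith) (by linarith)).2
    (by linarith)
  have e3 : (c t₂).2 = (c τ).2 := le_antisymm (hmax' t₂ hz₂) (by linarith)
  rw [e3] at ha₂
  exact ⟨τ, (c τ).2, (c t₁).2, t₁ - τ, t₂ - t₁, Prod.ext hτ0 rfl, by linarith, by linarith,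
    ha₁, ha₂⟩

end IsCrossingPeriodicSolution

/-! ### Conclusion -/

/-- Two nodes admit at most two pairs of matching arcs. -/
lemma nodeArc_matching_at_most_two {g h p q b : ℝ} (hg : 1 < g) (hgh : g < h) (hp : 0 < p)
    (hq : 0 < q) {y z t r : Fin 3 → ℝ} (ht : ∀ i, 0 < t i) (hr : ∀ i, 0 < r i)
    (h1 : ∀ i, NodeArc g p (t i) (y i) (z i))
    (h2 : ∀ i, NodeArc h q (r i) (y i - b) (z i - b)) : ¬ Function.Injective y := by
  intro hinj
  have hd : ∀ i, p * Real.arcDiff g (t i) = q * Real.arcDiff h (r i) := fun i => by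
    rw [← ((h1 i).sub_add_eq hg (ht i)).1, ← ((h2 i).sub_add_eq (hg.trans hgh) (hr i)).1]
    ring
  have hs : ∀ i, p * Real.arcSum g (t i) = q * Real.arcSum h (r i) + 2 * b := fun i => by
    rw [← ((h1 i).sub_add_eq hg (ht i)).2, ← ((h2 i).sub_add_eq (hg.trans hgh) (hr i)).2]
    ring
  have no_chain : ∀ i j k, t i < t j → t j < t k → False := fun i j k hij hjk =>
    Real.arc_matching_at_most_two hg hgh hp hq (ht i) hij hjk (hr i) (hr j) (hr k)
      (hd i) (hd j) (hd k) (hs i) (hs j) (hs k)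
  have hne : ∀ i j, i ≠ j → t i ≠ t j := by
    intro i j hij h
    apply hij
    apply hinj
    exact le_antisymm (((h1 i).time_le_iff (h1 j) hg hp (ht i) (ht j)).1.1 h.le)
      (((h1 j).time_le_iff (h1 i) hg hp (ht j) (ht i)).1.1 h.ge)
  -- Three distinct durations always contain a chain of three in increasing order, whichever indices
  -- realize it.
  rcases (hne 0 1 (by decide)).lt_or_gt with a | a <;>
  rcases (hne 1 2 (by decide)).lt_or_gt with b | b <;>
  rcases (hne 0 2 (by decide)).lt_or_gt with d | d <;>
  first
  | exact no_chain _ _ _ a b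
  | exact no_chain _ _ _ b a
  | exact no_chain _ _ _ a d
  | exact no_chain _ _ _ d a
  | exact no_chain _ _ _ b d
  | exact no_chain _ _ _ d b

theorem mainTheorem4 (γL γR αL αR b : ℝ)
    (hnodeL : 1 < |γL|) (hnodeR : 1 < |γR|) (hαL : 0 < αL) (hαR : αR < 0)
    (hγL : 0 < γL) (hγR : γR < 0) (hb : 0 < b) (hsum : γL + γR < 0) :
    {Γ : Set (ℝ × ℝ) |
      IsCrossingLimitCycle (nodeField γL αL 0) (nodeField γR αR b) Γ}.encard ≤ 2 := by
  have hL : 1 < γL := by rwa [abs_of_pos hγL] at hnodeL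
  have hR : γR < -1 := by
    rw [abs_of_neg hγR] at hnodeR
    linarith
  by_contra! hcard
  have h3 : (3 : ℕ∞) ≤ _ := Order.add_one_le_of_lt hcard
  obtain ⟨S, hS, hS3⟩ := Set.exists_subset_encard_eq h3
  obtain ⟨Γ₀, Γ₁, Γ₂, h01, h02, h12, rfl⟩ := Set.encard_eq_three.1 hS3
  have hex : ∀ i : Fin 3, ∃ T c, IsCrossingPeriodicSolution (nodeField γL αL 0)
      (nodeField γR αR b) T c ∧ Set.range c = ![Γ₀, Γ₁, Γ₂] i := by
    intro i
    fin_cases i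
    · exact (hS (by simp)).1
    · exact (hS (by simp)).1
    · exact (hS (by simp)).1
  choose T c hc hrange using hex
  choose τ y z t r hτ ht hr h1 h2 using
    fun i => (hc i).exists_closed_arcs hL hR hαL hαR hb
  -- Equal starting ordinates would give two of the orbits a common point on `x = 0`, hence make
  -- them equal.
  refine nodeArc_matching_at_most_two hL (by linarith) hαL (neg_pos.2 hαR) ht hr h1 h2 ?_
  intro i j hij
  have hrij := (hc i).range_eq_of_eq (hc j) hnodeL hnodeR hb
    (t := τ i) (t' := τ j) (by rw [hτ, hτ, hij])
  rw [hrange, hrange] at hrij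
  fin_cases i <;> fin_cases j <;> simp_all
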